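/- All rings are commutative with identity. Let $R$ be an integral domain with quotient field $K$, write $R^\bullet = R\setminus\{0\}$ for its multiplicative monoid, let $$\widehat R=\{x\in K \mid \text{there is } c\in R^\bullet \text{ such that } cx^n\in R \text{ for all } n\in\mathbb N\}$$ be its complete integral closure, $(R:\widehat R)=\{x\in K\mid x\widehat R\subseteq R\}$ its conductor, and let $\mathfrak X(\cdot)$ denote the set of height-one prime ideals of a domain. $R$ is a Mori domain if it satisfies the ascending chain condition on nonzero ideals $I$ of $R$ with $(R:(R:I))=I$. Let $H$ be a cancellative commutative monoid with unit group $H^\times$ and quotient group $\mathsf q(H)$, and let $\widehat H=\{x\in\mathsf q(H)\mid \text{there is } c\in H \text{ such that } cx^n\in H \text{ for all } n\in\mathbb N\}$. $H$ is called finitely primary (of rank $s$ and exponent $\alpha$) if there are integers $s,\alpha\ge 1$ and a factorial monoid $F=F^\times\times\mathcal F(\{p_1,\dots,p_s\})$ (that is, $F$ has exactly $s$ prime elements $p_1,\dots,p_s$ up to associates) such that $H\subseteq F$, $H\setminus H^\times\subseteq p_1\cdots p_sF$ and $(p_1\cdots p_s)^\alpha F\subseteq H$; then necessarily $F=\widehat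 H$. A finitely primary monoid $H$ of rank $s$ is called strongly ring-like if there are an exponent $\alpha\ge 1$ of $H$ and a system $p_1,\dots,p_s$ of representatives (up to associates) of the prime elements of $\widehat H$ such that - for all $i\in\{1,\dots,s\}$ and all $a\in\widehat H$ with $\mathsf v_{p_i}(a)\ge\alpha$, we have $p_ia\in H$ if and only if $a\in H$; - the group $\widehat H^\times/H^\times$ is finite; - the set $\{(\mathsf v_{p_1}(a),\dots,\mathsf v_{p_s}(a))\mid a\in H\setminus H^\times\}\subseteq\mathbb N^s$ has a smallest element with respect to the product order. **Proposition 5.9.** Let $R$ be a Mori domain such that $(R:\widehat R)\ne\{0\}$ and let $\mathfrak p\in\mathfrak X(R)$. 1. $R_{\mathfrak p}^\bullet$ is a finitely primary monoid. 2. Every prime ideal $\mathfrak m$ of $\widehat R$ with $\mathfrak m\cap R=\mathfrak p$ satisfies $\mathfrak m\in\mathfrak X(\widehat R)$. In particular, $\{\mathfrak m\in\operatorname{spec}(\widehat R)\mid\mathfrak m\cap R=\mathfrak p\}=\{\mathfrak m\in\mathfrak X(\widehat R)\mid\mathfrak m\cap R=\mathfrak p\}$. 3. If $\mathfrak p\supseteq(R:\widehat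 R)$, then $R_{\mathfrak p}^\bullet$ is strongly ring-like of rank at most two if and only if $R_{\mathfrak p}$ is Noetherian, $R/\mathfrak p$ is finite, and $|\{\mathfrak m\in\mathfrak X(\widehat R)\mid\mathfrak m\cap R=\mathfrak p\}|\le 2$. -/

import Mathlib

/-! ### Cancellative monoids

A (commutative) cancellative monoid `H` is the same as a submonoid of an abelian group `G`, and the
quotient group of `H` is then the subgroup of `G` generated by `H`. All the notions below depend
only on `H` and not on the surrounding group. -/

section Monoids

/-- The map `F^× × ℕ₀^s → F`, `(u, n) ↦ u * p_1 ^ n_1 * ⋯ * p_s ^ n_s`. -/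
def factorMap {F : Type*} [CommMonoid F] {s : ℕ} (p : Fin s → F) : Fˣ × (Fin s → ℕ) → F :=
  fun x => (x.1 : F) * ∏ i, p i ^ x.2 i

/-- `F = F^× × ℱ({p_1, …, p_s})`, that is, `F` is a factorial monoid and `p_1, …, p_s` is a system
of representatives of its prime elements (up to associates, without repetition). -/
def IsPrimeSystem {F : Type*} [CommMonoid F] {s : ℕ} (p : Fin s → F) : Prop :=
  Function.Bijective (factorMap p)

/-- The exponents `(v_{p_1}(a), …, v_{p_s}(a))` of `a` in the factorization of `a`. -/
noncomputable def IsPrimeSystem.val {F : Type*} [CommMonoid F] {s : ℕ} {p : Fin s → F}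
    (hp : IsPrimeSystem p) (a : F) : Fin s → ℕ :=
  ((Equiv.ofBijective (factorMap p) hp).symm a).2

variable {G : Type*} [CommGroup G]

/-- The group `H^×` of invertible elements of `H`. -/
def unitGroup (H : Submonoid G) : Subgroup G where
  carrier := {x | x ∈ H ∧ x⁻¹ ∈ H}
  one_mem' := ⟨H.one_mem, by simp⟩
  mul_mem' := by
    rintro a b ⟨ha, ha'⟩ ⟨hb, hb'⟩
    exact ⟨H.mul_mem ha hb, by rw [mul_inv]; exact H.mul_mem ha' hb'⟩
  inv_mem' := by
    rintro a ⟨ha, ha'⟩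
    exact ⟨ha', by simpa using ha⟩

/-- The complete integral closure `Ĥ` of `H`: the elements `x` of the quotient group for which
there is `c ∈ H` with `c x ^ n ∈ H` for all positive `n`. -/
def hatMonoid (H : Submonoid G) : Submonoid G where
  carrier := {x | x ∈ Subgroup.closure (H : Set G) ∧ ∃ c ∈ H, ∀ n : ℕ, 0 < n → c * x ^ n ∈ H}
  one_mem' := ⟨Subgroup.one_mem _, 1, H.one_mem, fun n _ => by simp⟩
  mul_mem' := by
    rintro a b ⟨ha, c, hc, hca⟩ ⟨hb, d, hd, hdb⟩
    refine ⟨Subgroup.mul_mem _ ha hb, c * d, H.mul_mem hc hd, fun n hn => ?_⟩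
    rw [mul_pow, mul_mul_mul_comm]
    exact H.mul_mem (hca n hn) (hdb n hn)

/-- `H` is finitely primary of rank `s` and exponent `α`: both are positive and there is a
factorial monoid `F = F^× × ℱ({p_1, …, p_s})` containing `H` with
`H \ H^× ⊆ p_1 ⋯ p_s F` and `(p_1 ⋯ p_s) ^ α F ⊆ H`. -/
def IsFinitelyPrimaryWith (H : Submonoid G) (s α : ℕ) : Prop :=
  0 < s ∧ 0 < α ∧ ∃ F : Submonoid G, H ≤ F ∧ ∃ p : Fin s → F, IsPrimeSystem p ∧
    (∀ a ∈ H, a ∉ unitGroup H → ∃ b ∈ F, a = (∏ i, (p i : G)) * b) ∧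
    ∀ b ∈ F, (∏ i, (p i : G)) ^ α * b ∈ H

/-- `H` is a finitely primary monoid. -/
def IsFinitelyPrimary (H : Submonoid G) : Prop :=
  ∃ s α : ℕ, IsFinitelyPrimaryWith H s α

/-- `H` is a strongly ring-like monoid of rank `s`. -/
def IsStronglyRingLike (H : Submonoid G) (s : ℕ) : Prop :=
  ∃ α : ℕ, IsFinitelyPrimaryWith H s α ∧
    ∃ (p : Fin s → hatMonoid H) (hp : IsPrimeSystem p),
      (∀ (i : Fin s) (a : hatMonoid H), α ≤ hp.val a i →
        (((p i * a : hatMonoid H) : G) ∈ H ↔ (a : G) ∈ H)) ∧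
      Finite (unitGroup (hatMonoid H) ⧸ (unitGroup H).subgroupOf (unitGroup (hatMonoid H))) ∧
      ∃ m : Fin s → ℕ,
        IsLeast {v | ∃ a : hatMonoid H, (a : G) ∈ H ∧ (a : G) ∉ unitGroup H ∧ v = hp.val a} m

end Monoids

/-! ### Domains

Here `R` is a domain with quotient field `K`; its complete integral closure is the subalgebra
`completeIntegralClosure R K` of `K`. -/

section Domains

variable (R K : Type*) [CommRing R] [Field K] [Algebra R K]

/-- The monoid `R^• = R \ {0}`, as a submonoid of the multiplicative group of `K`. -/
def nonzeroMonoid : Submonoid Kˣ :=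
  (MonoidHom.mrange (algebraMap R K)).comap (Units.coeHom K)

/-- The conductor `(R : R̂) = {x ∈ K | x R̂ ⊆ R}`; it is contained in `R` since `1 ∈ R̂`, and is
given here as an ideal of `R`. -/
def hatConductor : Ideal R where
  carrier := {r | ∀ y ∈ completeIntegralClosure R K,
    algebraMap R K r * y ∈ (algebraMap R K).range}
  zero_mem' := fun y _ => by simp
  add_mem' := by
    intro a b ha hb y hy
    rw [map_add, add_mul]
    exact add_mem (ha y hy) (hb y hy)
  smul_mem' := by
    intro c a ha y hy
    rw [smul_eq_mul, map_mul, mul_assoc]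
    exact mul_mem ⟨c, rfl⟩ (ha y hy)

/-- The `v`-closure `X_v = (R : (R : X))` of an `R`-submodule `X` of `K`; here `1` is the
submodule `R` of `K` and `A / B = (A : B) = {x ∈ K | x B ⊆ A}`. -/
noncomputable def vClosure (X : Submodule R K) : Submodule R K := 1 / (1 / X)

/-- `I` is a nonzero divisorial ideal (a `v`-ideal) of `R`. -/
def IsDivisorialIdeal (I : Ideal R) : Prop :=
  I ≠ ⊥ ∧ vClosure R K (Submodule.map (Algebra.linearMap R K) I) = Submodule.map (Algebra.linearMap R K) I

/-- `R` is a Mori domain: a domain satisfying the ascending chain condition on divisorial ideals. -/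
def IsMoriDomain : Prop :=
  IsDomain R ∧ ∀ I : ℕ →o Ideal R, (∀ n, IsDivisorialIdeal R K (I n)) →
    ∃ n, ∀ m, n ≤ m → I m = I n

end Domains

/-!
Write `A = R_p`, `R̂` and `Â` for the complete integral closures of `R` and `A` in `K`, and
`(A : X) = {y ∈ K | y X ⊆ A}`.

The Mori property is used only in the following form (`HasFiniteDuals`): a nonzero dual `(R : X)` is
the dual of a finite subset of `X`. It passes to `A` and shows that `Â` is the localization of `R̂` at
`R \ p`; hence the conductor `(A : Â)` is nonzero. As `Â` is the dual of this conductor, it inherits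
the property, and it is completely integrally closed.

Since `p` has height one, every nonzero prime of `Â` lies over the maximal ideal `𝔪` of `A`. The
ideals maximal among those with `(Â : I) ≠ Â` are nonzero primes, so each contains `𝔪`, and the
finiteness property shows that there are only finitely many. They cover all nonunits, so by prime
avoidance they are the maximal ideals of `Â`. Complete integral closedness makes them invertible,
hence principal, and excludes other nonzero primes: `Â` is a principal ideal domain with finitely
many primes `q₁, …, q_s` (`HasFiniteDuals.isPrincipalIdealRing`). Thus `Â^•` is factorial,
`𝔪 ⊆ q₁ ⋯ q_s Â`, and the nonzero conductor contains a power of `q₁ ⋯ q_s`, so `A^•` is finitely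
primary. The primes of `R̂` over `p` correspond to the nonzero primes of `Â`, which have height one.

Suppose that `A^•` is strongly ring-like and that `p` contains the conductor of `R`; then `A ≠ Â`.
For `z ∈ Â \ A`, all but finitely many classes of `a ∈ A` modulo `𝔪` make `z + a` a unit, and
different classes give different elements of `Â^× / A^×`; so `A / 𝔪` is finite
(`IsOneDimLocalMori.finite_residue`). Every `b ∈ Â` becomes a unit after adding the product of the
primes not dividing `b`, so `Â` is generated over `A` by unit representatives and `2 ^ s` such
products (`IsOneDimLocalMori.moduleFinite_of_units`). It follows that `Â` modulo the conductor is
finite and `A` is Noetherian.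

Conversely, if `A` is Noetherian with finite residue field, then `Â` is a finite `A`-module and the
quotient of `Â` by the conductor is finite, whence so is `Â^× / A^×`. Normalizing each prime to be
congruent to `1` modulo a high power of the others makes multiplication by `q_i` the identity modulo
`A` on elements highly divisible by `q_i`. For `s ≤ 2`, a smallest exponent vector is attained by one
of two elements minimal at one prime each, or by their sum.
-/

/-! ### Duals and almost integral elements -/

section Duals

variable (A K : Type*) [CommRing A] [Field K] [Algebra A K]

/-- The dual `(A : X) = {y ∈ K | y X ⊆ A}` of a subset `X` of `K`. -/
def dualSubmodule (X : Set K) : Submodule A K where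
  carrier := {y | ∀ x ∈ X, y * x ∈ (algebraMap A K).range}
  zero_mem' := fun x _ => by simp
  add_mem' := by
    intro a b ha hb x hx
    rw [add_mul]
    exact add_mem (ha x hx) (hb x hx)
  smul_mem' := by
    intro c a ha x hx
    rw [Algebra.smul_def, mul_assoc]
    exact mul_mem ⟨c, rfl⟩ (ha x hx)

/-- Every dual `(A : X) ≠ 0` is already the dual of a finite subset of `X`. This is the form in
which the ascending chain condition on divisorial ideals is used; unlike that condition, it makes
no reference to ideals and passes easily to localizations and to the complete integral closure. -/
def HasFiniteDuals : Prop :=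
  ∀ X : Set K, (∃ c ∈ dualSubmodule A K X, c ≠ 0) →
    ∃ E : Finset K, (E : Set K) ⊆ X ∧ dualSubmodule A K E ≤ dualSubmodule A K X

variable {A K}

theorem dualSubmodule_anti {X Y : Set K} (h : X ⊆ Y) :
    dualSubmodule A K Y ≤ dualSubmodule A K X :=
  fun _ hy x hx => hy x (h hx)

/-- Duals are divisorial, since `(A : (A : (A : X))) = (A : X)`. -/
theorem vClosure_dualSubmodule (X : Set K) :
    vClosure A K (dualSubmodule A K X) = dualSubmodule A K X := by
  have hone : ∀ z : K, z ∈ (1 : Submodule A K) ↔ z ∈ (algebraMap A K).range := fun z =>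
    Submodule.mem_one
  apply le_antisymm
  · intro k hk x hx
    rw [← hone]
    refine Submodule.mem_div_iff_forall_mul_mem.1 hk x ?_
    refine Submodule.mem_div_iff_forall_mul_mem.2 fun y hy => ?_
    rw [hone, mul_comm]
    exact hy x hx
  · intro k hk
    refine Submodule.mem_div_iff_forall_mul_mem.2 fun y hy => ?_
    rw [mul_comm]
    exact Submodule.mem_div_iff_forall_mul_mem.1 hy k hk

/-- If no finite `E ⊆ X` had the dual of `X`, the divisorial ideals `c (A : (A : E))`, where
`0 ≠ c ∈ (A : X)` makes them integral, would have no maximal member. -/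
theorem IsMoriDomain.hasFiniteDuals [IsFractionRing A K] (h : IsMoriDomain A K) :
    HasFiniteDuals A K := by
  classical
  rintro X ⟨c, hc, hc0⟩
  by_cases hX : ∃ x ∈ X, x ≠ 0
  swap
  · push Not at hX
    refine ⟨∅, by simp, fun y _ x hx => ?_⟩
    rw [hX x hx]
    simp
  obtain ⟨x₀, hx₀, hx₀0⟩ := hX
  -- The integral divisorial ideals `c (A : (A : E))` for finite subsets `E` of `X`.
  let Y : Finset K → Set K := fun E => {z | ∃ y ∈ dualSubmodule A K E, z = c⁻¹ * y}
  let I : Finset K → Ideal A := fun E =>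
    (dualSubmodule A K (Y E)).comap (Algebra.linearMap A K)
  have hmemI : ∀ (E : Finset K) (r : A), r ∈ I E ↔
      ∀ y ∈ dualSubmodule A K (E : Set K),
        algebraMap A K r * (c⁻¹ * y) ∈ (algebraMap A K).range := by
    intro E r
    constructor
    · intro hr y hy
      exact hr _ ⟨y, hy, rfl⟩
    · rintro hr _ ⟨y, hy, rfl⟩
      exact hr y hy
  have hcx : ∀ E : Finset K, (E : Set K) ⊆ X → ∀ x ∈ E, ∃ r ∈ I E, algebraMap A K r = c * x := by
    intro E hE x hx
    obtain ⟨r, hr⟩ := hc x (hE hx)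
    refine ⟨r, (hmemI E r).2 fun y hy => ?_, hr⟩
    rw [hr]
    convert hy x hx using 1
    field_simp
  have hdiv : ∀ E : Finset K, x₀ ∈ E → (E : Set K) ⊆ X → IsDivisorialIdeal A K (I E) := by
    intro E hE hEX
    constructor
    · obtain ⟨r, hr, hrc⟩ := hcx E hEX x₀ hE
      intro hbot
      rw [hbot, Ideal.mem_bot] at hr
      rw [hr, map_zero] at hrc
      exact mul_ne_zero hc0 hx₀0 hrc.symm
    · have hmap : Submodule.map (Algebra.linearMap A K) (I E) = dualSubmodule A K (Y E) := by
        apply le_antisymm (Submodule.map_comap_le _ _)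
        intro k hk
        obtain ⟨r, hr⟩ := hk 1 ⟨c, dualSubmodule_anti hEX hc, (inv_mul_cancel₀ hc0).symm⟩
        rw [mul_one] at hr
        exact ⟨r, by simpa [I, hr] using hk, hr⟩
      rw [hmap, vClosure_dualSubmodule]
  have hwf : WellFoundedGT {J : Ideal A // IsDivisorialIdeal A K J} := by
    rw [wellFoundedGT_iff_monotone_chain_condition]
    intro f
    obtain ⟨n, hn⟩ := h.2 ⟨fun n => (f n).1, fun _ _ hab => f.2 hab⟩ fun n => (f n).2
    exact ⟨n, fun m hm => Subtype.ext (hn m hm).symm⟩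
  obtain ⟨J, ⟨E, hxE, hEX, hJ⟩, hmax⟩ := hwf.wf.has_min
    {J : {J : Ideal A // IsDivisorialIdeal A K J} |
      ∃ E : Finset K, x₀ ∈ E ∧ (E : Set K) ⊆ X ∧ J.1 = I E}
    ⟨⟨I {x₀}, hdiv _ (by simp) (by simpa using hx₀)⟩, {x₀}, by simp, by simpa using hx₀, rfl⟩
  refine ⟨E, hEX, fun y hy x hx => ?_⟩
  have hE' : ((insert x E : Finset K) : Set K) ⊆ X := by
    rw [Finset.coe_insert]
    exact Set.insert_subset hx hEX
  have hle : I E ≤ I (insert x E) := by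
    intro r hr
    rw [hmemI] at hr ⊢
    exact fun y hy => hr y (dualSubmodule_anti (by simp) hy)
  have heq : I (insert x E) = I E := by
    by_contra hne
    refine hmax ⟨I (insert x E), hdiv _ (by simp [hxE]) hE'⟩
      ⟨_, by simp [hxE], hE', rfl⟩ ?_
    change J.1 < I (insert x E)
    rw [hJ]
    exact lt_of_le_of_ne hle fun h => hne h.symm
  obtain ⟨r, hr, hrc⟩ := hcx _ hE' x (by simp)
  rw [heq, hmemI] at hr
  have := hr y hy
  rw [hrc] at this
  convert this using 1
  field_simp

section Localization

variable {A' : Type*} [CommRing A'] [Algebra A A'] [Algebra A' K] [IsScalarTower A A' K]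

theorem mem_range_of_mem_range {x : K} (hx : x ∈ (algebraMap A K).range) :
    x ∈ (algebraMap A' K).range := by
  obtain ⟨a, rfl⟩ := hx
  exact ⟨algebraMap A A' a, (IsScalarTower.algebraMap_apply A A' K a).symm⟩

theorem exists_mul_mem_range_of_mem_range (M : Submonoid A) [IsLocalization M A']
    {x : K} (hx : x ∈ (algebraMap A' K).range) :
    ∃ s ∈ M, algebraMap A K s * x ∈ (algebraMap A K).range := by
  obtain ⟨a, rfl⟩ := hx
  obtain ⟨⟨r, s⟩, h⟩ := IsLocalization.surj M a
  refine ⟨s, s.2, r, ?_⟩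
  rw [IsScalarTower.algebraMap_apply A A' K, IsScalarTower.algebraMap_apply A A' K, ← h, map_mul,
    mul_comm]

theorem mem_range_of_mul_mem_range (M : Submonoid A) [IsLocalization M A']
    {x : K} {s : A} (hs : s ∈ M)
    (hx : algebraMap A K s * x ∈ (algebraMap A' K).range) : x ∈ (algebraMap A' K).range := by
  obtain ⟨a, ha⟩ := hx
  obtain ⟨u, hu⟩ := IsLocalization.map_units A' (⟨s, hs⟩ : M)
  refine ⟨↑u⁻¹ * a, ?_⟩
  rw [map_mul, ha, IsScalarTower.algebraMap_apply A A' K, ← mul_assoc, ← map_mul]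
  simp [← hu]

theorem exists_mul_mem_range_of_finset (M : Submonoid A) [IsLocalization M A']
    (E : Finset K) (y : K)
    (h : y ∈ dualSubmodule A' K E) :
    ∃ s ∈ M, algebraMap A K s * y ∈ dualSubmodule A K E := by
  classical
  induction E using Finset.induction_on with
  | empty => exact ⟨1, M.one_mem, fun x hx => by simp at hx⟩
  | insert e E _ ih =>
    obtain ⟨s, hs, hsE⟩ := ih (dualSubmodule_anti (by simp) h)
    obtain ⟨t, ht, hte⟩ := exists_mul_mem_range_of_mem_range (A' := A') M (h e (by simp))
    refine ⟨s * t, M.mul_mem hs ht, fun x hx => ?_⟩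
    rw [Finset.coe_insert, Set.mem_insert_iff] at hx
    rw [map_mul]
    rcases hx with rfl | hx
    · convert mul_mem (⟨s, rfl⟩ : algebraMap A K s ∈ (algebraMap A K).range) hte using 1
      ring
    · convert mul_mem (⟨t, rfl⟩ : algebraMap A K t ∈ (algebraMap A K).range) (hsE x hx) using 1
      ring

/-- The dual over the localization of a finite set is the localization of its dual, so finite
subsets found over `A` also work over `A'`. -/
theorem HasFiniteDuals.of_isLocalization (M : Submonoid A) [IsLocalization M A']
    (h : HasFiniteDuals A K) : HasFiniteDuals A' K := by
  classical
  rintro X ⟨c, hc, hc0⟩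
  have hs : ∀ x : K, ∃ s ∈ M, x ∈ X → algebraMap A K s * (c * x) ∈ (algebraMap A K).range := by
    intro x
    by_cases hx : x ∈ X
    · obtain ⟨s, hs, hsx⟩ := exists_mul_mem_range_of_mem_range (A' := A') M (hc x hx)
      exact ⟨s, hs, fun _ => hsx⟩
    · exact ⟨1, M.one_mem, fun h => absurd h hx⟩
  choose s hsM hs using hs
  obtain ⟨E', hE', hdual⟩ := h ((fun x => algebraMap A K (s x) * x) '' X)
    ⟨c, by
      rintro _ ⟨x, hx, rfl⟩
      convert hs x hx using 1
      ring, hc0⟩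
  obtain ⟨E, hE, rfl⟩ := Finset.subset_set_image_iff.1 hE'
  refine ⟨E, hE, fun y hy x hx => ?_⟩
  obtain ⟨t, ht, hty⟩ := exists_mul_mem_range_of_finset M E y hy
  have h1 : algebraMap A K t * y ∈ dualSubmodule A K
      (E.image (fun x => algebraMap A K (s x) * x) : Finset K) := by
    intro z hz
    rw [Finset.coe_image] at hz
    obtain ⟨e, he, rfl⟩ := hz
    convert mul_mem (⟨s e, rfl⟩ : algebraMap A K (s e) ∈ (algebraMap A K).range) (hty e he) using 1
    ring
  have h2 := hdual h1 _ ⟨x, hx, rfl⟩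
  refine mem_range_of_mul_mem_range M (M.mul_mem ht (hsM x)) ?_
  convert mem_range_of_mem_range (A' := A') h2 using 1
  rw [map_mul]
  ring

/-- If every dual is the dual of a finite set, the complete integral closure commutes with
localization. -/
theorem HasFiniteDuals.mem_completeIntegralClosure_iff (M : Submonoid A) [IsLocalization M A']
    [IsDomain A] [IsFractionRing A K]
    (h : HasFiniteDuals A K) (hM : M ≤ nonZeroDivisors A) [IsDomain A'] {x : K} :
    x ∈ completeIntegralClosure A' K ↔
      ∃ s ∈ M, algebraMap A K s * x ∈ completeIntegralClosure A K := by
  have hinj : Function.Injective (algebraMap A K) := IsFractionRing.injective A K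
  have hinj' : Function.Injective (algebraMap A A') := IsLocalization.injective A' hM
  constructor
  · rintro ⟨c', hc', hcx⟩
    -- `J` is the trace on `A` of the nonzero `A'`-ideal `(A' : {1, x, x², …})`, which is
    -- stable under multiplication by `x`.
    let J : Set K := {y | y ∈ (algebraMap A K).range ∧ ∀ n : ℕ, y * x ^ n ∈ (algebraMap A' K).range}
    obtain ⟨⟨c, s⟩, hcs⟩ := IsLocalization.surj M c'
    have hcJ : algebraMap A K c ∈ J := by
      refine ⟨⟨c, rfl⟩, fun n => ?_⟩
      have := hcx n
      rw [Algebra.smul_def] at this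
      rw [IsScalarTower.algebraMap_apply A A' K, ← hcs, map_mul, mul_right_comm]
      exact mul_mem this ⟨_, rfl⟩
    have hc0 : algebraMap A K c ≠ 0 := by
      rw [Ne, FaithfulSMul.algebraMap_eq_zero_iff]
      rintro rfl
      rw [map_zero] at hcs
      have h1 : c' ≠ 0 := nonZeroDivisors.ne_zero hc'
      have h2 : algebraMap A A' s ≠ 0 := (IsLocalization.map_units A' s).ne_zero
      exact mul_ne_zero h1 h2 hcs
    have h1J : (1 : K) ∈ dualSubmodule A K J := fun y hy => by rw [one_mul]; exact hy.1
    obtain ⟨F, hFJ, hF⟩ := h J ⟨1, h1J, one_ne_zero⟩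
    have hxF : x ∈ dualSubmodule A' K F := fun f hf => by
      have := (hFJ hf).2 1
      rwa [pow_one, mul_comm] at this
    obtain ⟨t, ht, htx⟩ := exists_mul_mem_range_of_finset M F x hxF
    refine ⟨t, ht, c, mem_nonZeroDivisors_of_ne_zero (by rintro rfl; simp at hc0), fun n => ?_⟩
    have hstab : ∀ n : ℕ, (algebraMap A K t * x) ^ n ∈ dualSubmodule A K J := by
      intro n
      induction n with
      | zero => rwa [pow_zero]
      | succ n ih =>
        refine hF fun f hf => ?_
        rw [pow_succ, mul_assoc]
        refine ih _ ⟨htx f hf, fun k => ?_⟩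
        have h1 := mul_mem (mem_range_of_mem_range (A' := A')
          (⟨t, rfl⟩ : algebraMap A K t ∈ (algebraMap A K).range)) ((hFJ hf).2 (k + 1))
        convert h1 using 1
        ring
    rw [Algebra.smul_def, mul_comm]
    exact hstab n _ hcJ
  · rintro ⟨s, hs, c, hc, hcx⟩
    refine ⟨algebraMap A A' c, mem_nonZeroDivisors_of_ne_zero ?_, fun n => ?_⟩
    · rw [Ne, map_eq_zero_iff _ hinj']
      exact nonZeroDivisors.ne_zero hc
    · refine mem_range_of_mul_mem_range M (M.pow_mem hs n) ?_
      have := mem_range_of_mem_range (A' := A') (hcx n)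
      rw [Algebra.smul_def] at this
      rw [Algebra.smul_def, ← IsScalarTower.algebraMap_apply]
      convert this using 1
      rw [mul_pow, map_pow]
      ring

theorem HasFiniteDuals.mem_completeIntegralClosure_of_mem (M : Submonoid A) [IsLocalization M A']
    [IsDomain A] [IsFractionRing A K]
    (h : HasFiniteDuals A K) (hM : M ≤ nonZeroDivisors A) [IsDomain A'] {x : K}
    (hx : x ∈ completeIntegralClosure A K) : x ∈ completeIntegralClosure A' K :=
  (h.mem_completeIntegralClosure_iff M hM).2 ⟨1, one_mem _, by rwa [map_one, one_mul]⟩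

end Localization

end Duals

/-! ### Completely integrally closed domains with finite duals -/

section Closure

variable {A K : Type*} [CommRing A] [Field K] [Algebra A K]

/-- The dual of the conductor is contained in the complete integral closure; the reverse inclusion
holds by definition. -/
theorem mem_completeIntegralClosure_of_mul_mem [IsDomain A] [IsFractionRing A K]
    (hg : hatConductor A K ≠ ⊥) {z : K}
    (hz : ∀ r ∈ hatConductor A K, algebraMap A K r * z ∈ (algebraMap A K).range) :
    z ∈ completeIntegralClosure A K := by
  obtain ⟨d, hd, hd0⟩ := Submodule.exists_mem_ne_zero_of_ne_bot hg
  have hstab : ∀ n : ℕ, ∃ r ∈ hatConductor A K, algebraMap A K r = algebraMap A K d * z ^ n := by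
    intro n
    induction n with
    | zero => exact ⟨d, hd, by simp⟩
    | succ n ih =>
      obtain ⟨r, hr, hrd⟩ := ih
      obtain ⟨r', hr'⟩ := hz r hr
      refine ⟨r', fun b hb => ?_, by rw [hr', hrd, pow_succ, mul_assoc]⟩
      obtain ⟨e, he⟩ := hr b hb
      have heg : e ∈ hatConductor A K := fun b' hb' => by
        rw [he, mul_assoc]
        exact hr _ (mul_mem hb hb')
      rw [hr', mul_right_comm, ← he]
      exact hz e heg
  refine ⟨d, mem_nonZeroDivisors_of_ne_zero hd0, fun n => ?_⟩
  obtain ⟨r, -, hr⟩ := hstab n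
  rw [Algebra.smul_def]
  exact ⟨r, hr⟩

theorem algebraMap_range_completeIntegralClosure {x : K} :
    x ∈ (algebraMap (completeIntegralClosure A K) K).range ↔ x ∈ completeIntegralClosure A K :=
  ⟨by rintro ⟨a, rfl⟩; exact a.2, fun h => ⟨⟨x, h⟩, rfl⟩⟩

instance isFractionRing_completeIntegralClosure [IsDomain A] [IsFractionRing A K] :
    IsFractionRing (completeIntegralClosure A K) K := by
  have : FaithfulSMul (completeIntegralClosure A K) K :=
    (faithfulSMul_iff_algebraMap_injective _ _).2 Subtype.val_injective
  refine IsFractionRing.of_field _ _ fun z => ?_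
  obtain ⟨a, b, -, rfl⟩ := IsFractionRing.div_surjective (A := A) z
  exact ⟨algebraMap A _ a, algebraMap A _ b, rfl⟩

/-- The complete integral closure `Â` is the dual `(A : 𝔣)` of the conductor `𝔣`, so
`(Â : X) = (A : 𝔣 X)`. -/
theorem HasFiniteDuals.completeIntegralClosure [IsDomain A] [IsFractionRing A K]
    (h : HasFiniteDuals A K) (hg : hatConductor A K ≠ ⊥) :
    HasFiniteDuals (completeIntegralClosure A K) K := by
  classical
  rintro X ⟨c, hc, hc0⟩
  obtain ⟨d, hd, hd0⟩ := Submodule.exists_mem_ne_zero_of_ne_bot hg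
  let f : A → K → K := fun r x => algebraMap A K r * x
  have hcX : c ∈ dualSubmodule A K (Set.image2 f (hatConductor A K) X) := by
    rintro _ ⟨r, hr, x, hx, rfl⟩
    convert hr _ (algebraMap_range_completeIntegralClosure.1 (hc x hx)) using 1
    simp only [f]
    ring
  obtain ⟨E', hE', hdual⟩ := h _ ⟨c, hcX, hc0⟩
  obtain ⟨G, E, hG, hE, hsub⟩ := Finset.subset_set_image₂ hE'
  refine ⟨E, hE, fun y hy x hx => ?_⟩
  have hyE : y ∈ dualSubmodule A K E' := by
    intro z hz
    obtain ⟨r, hr, e, he, rfl⟩ := Finset.mem_image₂.1 (hsub hz)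
    convert hG hr _ (algebraMap_range_completeIntegralClosure.1 (hy e he)) using 1
    simp only [f]
    ring
  rw [algebraMap_range_completeIntegralClosure]
  refine mem_completeIntegralClosure_of_mul_mem hg fun r hr => ?_
  convert hdual hyE _ ⟨r, hr, x, hx, rfl⟩ using 1
  simp only [f]
  ring

/-- If the conductor is nonzero, the complete integral closure is completely integrally closed. -/
theorem mem_completeIntegralClosure_of_isAlmostIntegral [IsDomain A] [IsFractionRing A K]
    (hg : hatConductor A K ≠ ⊥) {x : K} (hx : IsAlmostIntegral (completeIntegralClosure A K) x) :
    x ∈ completeIntegralClosure A K := by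
  obtain ⟨b, hb, hbx⟩ := hx
  obtain ⟨d, hd, hd0⟩ := Submodule.exists_mem_ne_zero_of_ne_bot hg
  obtain ⟨e, he⟩ := hd b b.2
  refine ⟨e, mem_nonZeroDivisors_of_ne_zero ?_, fun n => ?_⟩
  · rintro rfl
    rw [map_zero, eq_comm, mul_eq_zero, FaithfulSMul.algebraMap_eq_zero_iff] at he
    exact he.elim hd0 fun h => nonZeroDivisors.ne_zero hb (Subtype.ext h)
  · have := hd _ (algebraMap_range_completeIntegralClosure.1 (hbx n))
    rw [Algebra.smul_def] at this ⊢
    rw [he, mul_assoc]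
    exact this

end Closure

section SemilocalPID

variable {B K : Type*} [CommRing B] [Field K] [Algebra B K]

variable (K) in
/-- The ideals `I` of `B` with `(B : I) ≠ B`, that is, with `I_v ≠ B`. -/
def nondenseIdeals : Set (Ideal B) :=
  {I | ∃ y : K, y ∉ (algebraMap B K).range ∧
    ∀ x ∈ I, y * algebraMap B K x ∈ (algebraMap B K).range}

/-- Nondense ideals satisfy the hypothesis of Zorn's lemma. -/
theorem HasFiniteDuals.exists_le_maximal_nondense (h : HasFiniteDuals B K) {I : Ideal B}
    (hI : I ∈ nondenseIdeals K) : ∃ Q, I ≤ Q ∧ Maximal (· ∈ nondenseIdeals (B := B) K) Q := by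
  refine zorn_le_nonempty₀ (nondenseIdeals K) (fun c hc hchain J hJ => ?_) I hI
  have hne : c.Nonempty := ⟨J, hJ⟩
  have hmem : ∀ x, x ∈ sSup c ↔ ∃ J ∈ c, x ∈ J :=
    fun x => Submodule.mem_sSup_of_directed hne hchain.directedOn
  refine ⟨sSup c, ?_, fun _ hz => le_sSup hz⟩
  -- A finite part of the union with the same dual lies in one member of the chain.
  obtain ⟨E, hE, hdual⟩ := h (algebraMap B K '' (sSup c : Ideal B))
    ⟨1, by rintro _ ⟨x, -, rfl⟩; exact ⟨x, by simp⟩, one_ne_zero⟩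
  have hfin : ∀ F : Finset K, (F : Set K) ⊆ algebraMap B K '' (sSup c : Ideal B) →
      ∃ J ∈ c, (F : Set K) ⊆ algebraMap B K '' (J : Ideal B) := by
    classical
    intro F
    induction F using Finset.induction_on with
    | empty => exact fun _ => ⟨J, hJ, by simp⟩
    | insert e F _ ih =>
      intro hF
      rw [Finset.coe_insert, Set.insert_subset_iff] at hF
      obtain ⟨⟨x, hx, rfl⟩, hF⟩ := hF
      obtain ⟨J₁, hJ₁, hF₁⟩ := ih hF
      obtain ⟨J₂, hJ₂, hx₂⟩ := (hmem x).1 hx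
      obtain ⟨J₃, hJ₃, h₁, h₂⟩ := hchain.directedOn _ hJ₁ _ hJ₂
      refine ⟨J₃, hJ₃, ?_⟩
      rw [Finset.coe_insert, Set.insert_subset_iff]
      exact ⟨⟨x, h₂ hx₂, rfl⟩, hF₁.trans (Set.image_mono h₁)⟩
  obtain ⟨J', hJ', hEJ⟩ := hfin E hE
  obtain ⟨y, hy, hyJ⟩ := hc hJ'
  refine ⟨y, hy, fun x hx => hdual ?_ _ ⟨x, hx, rfl⟩⟩
  intro e he
  obtain ⟨x, hx, rfl⟩ := hEJ he
  exact hyJ x hx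

/-- If `y Q ⊆ B` with `y ∉ B`, then `Q = {r | r y ∈ B}` by maximality, and the same holds for every
multiple `b y ∉ B`. -/
theorem isPrime_of_maximal_nondense {Q : Ideal B}
    (hQ : Maximal (· ∈ nondenseIdeals (B := B) K) Q) : Q.IsPrime := by
  obtain ⟨y, hy, hyQ⟩ := hQ.prop
  refine ⟨fun htop => hy ?_, fun {a b} hab => ?_⟩
  · simpa using hyQ 1 (htop ▸ Submodule.mem_top)
  · by_contra! hcon
    obtain ⟨ha, hb⟩ := hcon
    have key : ∀ z : K, z ∉ (algebraMap B K).range →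
        (∀ x ∈ Q, z * algebraMap B K x ∈ (algebraMap B K).range) →
        ∀ r : B, z * algebraMap B K r ∈ (algebraMap B K).range → r ∈ Q := by
      intro z hz hzQ r hr
      have hle := hQ.le_of_ge (y := Submodule.comap (Algebra.linearMap B K)
        (dualSubmodule B K {z})) ⟨z, hz, fun x hx => by
          have := hx z rfl
          rwa [mul_comm] at this⟩ fun x hx z' hz' => by
          rw [Set.mem_singleton_iff.1 hz', mul_comm]
          exact hzQ x hx
      refine hle fun z' hz' => ?_
      rw [Set.mem_singleton_iff.1 hz', mul_comm]
      exact hr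
    have hyb : y * algebraMap B K b ∉ (algebraMap B K).range := fun h => hb (key y hy hyQ b h)
    refine ha (key _ hyb (fun x hx => ?_) a ?_)
    · rw [mul_assoc, ← map_mul]
      exact hyQ _ (Q.mul_mem_left b hx)
    · rw [mul_assoc, ← map_mul, mul_comm b]
      exact hyQ _ hab

/-- If `y P ⊆ P` for a nonzero ideal `P`, then `y` is almost integral. -/
theorem isAlmostIntegral_of_mul_mem [IsDomain B] {P : Ideal B} (hP : P ≠ ⊥) {y : K}
    (hy : ∀ x ∈ P, ∃ z ∈ P, algebraMap B K z = y * algebraMap B K x) : IsAlmostIntegral B y := by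
  obtain ⟨c, hc, hc0⟩ := Submodule.exists_mem_ne_zero_of_ne_bot hP
  have : ∀ n : ℕ, ∃ z ∈ P, algebraMap B K z = y ^ n * algebraMap B K c := by
    intro n
    induction n with
    | zero => exact ⟨c, hc, by simp⟩
    | succ n ih =>
      obtain ⟨z, hz, hzc⟩ := ih
      obtain ⟨z', hz', hz'z⟩ := hy z hz
      exact ⟨z', hz', by rw [hz'z, hzc]; ring⟩
  refine ⟨c, mem_nonZeroDivisors_of_ne_zero hc0, fun n => ?_⟩
  obtain ⟨z, -, hz⟩ := this n
  exact ⟨z, by rw [hz, Algebra.smul_def, mul_comm]⟩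

variable [IsFractionRing B K]

theorem span_singleton_mem_nondenseIdeals {x : B} (hx0 : x ≠ 0) (hx : ¬IsUnit x) :
    Ideal.span {x} ∈ nondenseIdeals (B := B) K := by
  have hxK : algebraMap B K x ≠ 0 := by rwa [Ne, FaithfulSMul.algebraMap_eq_zero_iff]
  refine ⟨(algebraMap B K x)⁻¹, ?_, fun z hz => ?_⟩
  · rintro ⟨b, hb⟩
    refine hx (IsUnit.of_mul_eq_one b (FaithfulSMul.algebraMap_injective B K ?_))
    rw [map_mul, hb, mul_inv_cancel₀ hxK, map_one]
  · obtain ⟨b, rfl⟩ := Ideal.mem_span_singleton'.1 hz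
    exact ⟨b, by rw [map_mul]; field_simp⟩

/-- The maximal nondense ideals are the sets `Q = {r | r y_Q ∈ B}`; as finitely many of the `y_Q`
have the same dual as all of them, every maximal nondense ideal contains an
intersection of finitely many fixed ones. -/
theorem HasFiniteDuals.finite_maximal_nondense (h : HasFiniteDuals B K) {t : B} (ht0 : t ≠ 0)
    (ht : ∀ Q, Maximal (· ∈ nondenseIdeals (B := B) K) Q → t ∈ Q) :
    {Q | Maximal (· ∈ nondenseIdeals (B := B) K) Q}.Finite := by
  classical
  choose! y hy hyQ using
    fun (Q : Ideal B) (hQ : Maximal (· ∈ nondenseIdeals (B := B) K) Q) => hQ.prop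
  obtain ⟨E', hE', hdual⟩ := h (y '' {Q | Maximal (· ∈ nondenseIdeals (B := B) K) Q})
    ⟨algebraMap B K t, by
      rintro _ ⟨Q, hQ, rfl⟩
      rw [mul_comm]
      exact hyQ Q hQ t (ht Q hQ), by rwa [Ne, FaithfulSMul.algebraMap_eq_zero_iff]⟩
  obtain ⟨E, hE, rfl⟩ := Finset.subset_set_image_iff.1 hE'
  refine E.finite_toSet.subset fun Q hQ => ?_
  have hle : E.inf id ≤ Q := by
    intro x hx
    have hxE : ∀ Q' ∈ E, x ∈ Q' := fun Q' hQ' => (Finset.inf_le (f := id) hQ') hx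
    have hxd : algebraMap B K x * y Q ∈ (algebraMap B K).range := by
      refine hdual ?_ _ ⟨Q, hQ, rfl⟩
      intro z hz
      rw [Finset.coe_image] at hz
      obtain ⟨Q', hQ', rfl⟩ := hz
      rw [mul_comm]
      exact hyQ Q' (hE hQ') x (hxE Q' hQ')
    refine hQ.le_of_ge (y := Submodule.comap (Algebra.linearMap B K)
      (dualSubmodule B K {y Q})) ⟨y Q, hy Q hQ, fun x hx => ?_⟩ (fun x hx z hz => ?_) ?_
    · have := hx _ rfl
      rwa [mul_comm] at this
    · rw [Set.mem_singleton_iff.1 hz, mul_comm]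
      exact hyQ Q hQ x hx
    · intro z hz
      rw [Set.mem_singleton_iff.1 hz]
      exact hxd
  obtain ⟨Q', hQ', hle'⟩ := (Ideal.IsPrime.inf_le' (isPrime_of_maximal_nondense hQ)).1 hle
  have : Q = Q' := le_antisymm ((hE hQ').le_of_ge hQ.prop hle') hle'
  rw [this]
  exact hQ'

variable [IsDomain B]

theorem ne_bot_of_maximal_nondense (hB : ¬IsField B) {Q : Ideal B}
    (hQ : Maximal (· ∈ nondenseIdeals (B := B) K) Q) : Q ≠ ⊥ := by
  rintro rfl
  obtain ⟨x, hx0, hx⟩ := Ring.exists_not_isUnit_of_not_isField hB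
  have := hQ.le_of_ge (span_singleton_mem_nondenseIdeals hx0 hx) bot_le
  rw [le_bot_iff, Ideal.span_singleton_eq_bot] at this
  exact hx0 this

/-- The maximal ideals are exactly the maximal nondense ideals, by prime avoidance. -/
theorem HasFiniteDuals.maximal_nondense_of_isMaximal (h : HasFiniteDuals B K) {t : B}
    (ht0 : t ≠ 0) (ht : ∀ P : Ideal B, P.IsPrime → P ≠ ⊥ → t ∈ P) (hB : ¬IsField B)
    {P : Ideal B} (hP : P.IsMaximal) : Maximal (· ∈ nondenseIdeals (B := B) K) P := by
  have hfin := h.finite_maximal_nondense ht0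
    fun Q hQ => ht Q (isPrime_of_maximal_nondense hQ) (ne_bot_of_maximal_nondense hB hQ)
  have hPbot : P ≠ ⊥ := Ring.ne_bot_of_isMaximal_of_not_isField hP hB
  obtain ⟨x₀, hx₀, hx₀0⟩ := Submodule.exists_mem_ne_zero_of_ne_bot hPbot
  have hnu : ∀ x ∈ P, ¬IsUnit x := fun x hx hu => hP.ne_top (P.eq_top_of_isUnit_mem hx hu)
  have hsub : (P : Set B) ⊆ ⋃ Q ∈ (hfin.toFinset : Set (Ideal B)), (Q : Set B) := by
    intro x hx
    obtain ⟨z, hz, hz0, hxz⟩ : ∃ z ∈ P, z ≠ 0 ∧ x ∈ Ideal.span {z} := by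
      by_cases hx0 : x = 0
      · exact ⟨x₀, hx₀, hx₀0, hx0 ▸ zero_mem _⟩
      · exact ⟨x, hx, hx0, Ideal.mem_span_singleton_self x⟩
    obtain ⟨Q, hle, hQ⟩ := h.exists_le_maximal_nondense
      (span_singleton_mem_nondenseIdeals hz0 (hnu z hz))
    simp only [Set.mem_iUnion]
    exact ⟨Q, by simpa using hQ, hle hxz⟩
  obtain ⟨Q, hQ, hPQ⟩ := (Ideal.subset_union_prime (f := id) ⊥ ⊥ fun Q hQ _ _ =>
    isPrime_of_maximal_nondense (K := K) (by simpa using hQ)).1 hsub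
  have hQ' : Maximal (· ∈ nondenseIdeals (B := B) K) Q := by simpa using hQ
  have : P = Q := hP.eq_of_le (isPrime_of_maximal_nondense hQ').ne_top hPQ
  rwa [this]

theorem HasFiniteDuals.finite_isMaximal (h : HasFiniteDuals B K) {t : B}
    (ht0 : t ≠ 0) (ht : ∀ P : Ideal B, P.IsPrime → P ≠ ⊥ → t ∈ P) (hB : ¬IsField B) :
    {P : Ideal B | P.IsMaximal}.Finite := by
  refine (h.finite_maximal_nondense ht0 fun Q hQ =>
    ht Q (isPrime_of_maximal_nondense hQ) (ne_bot_of_maximal_nondense hB hQ)).subset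
    fun P hP => h.maximal_nondense_of_isMaximal ht0 ht hB hP

theorem HasFiniteDuals.isPrincipal_of_isMaximal (h : HasFiniteDuals B K)
    (hcic : ∀ x : K, IsAlmostIntegral B x → x ∈ (algebraMap B K).range) {t : B}
    (ht0 : t ≠ 0) (ht : ∀ P : Ideal B, P.IsPrime → P ≠ ⊥ → t ∈ P) (hB : ¬IsField B)
    {P : Ideal B} (hP : P.IsMaximal) : P.IsPrincipal := by
  obtain ⟨y, hy, hyP⟩ := (h.maximal_nondense_of_isMaximal ht0 ht hB hP).prop
  have hPbot : P ≠ ⊥ := Ring.ne_bot_of_isMaximal_of_not_isField hP hB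
  -- As `y P ⊈ P`, the ideals `P` and `y P` are comaximal, so `(1, y)` is inverse to `P`.
  obtain ⟨x, hx, z, hz, hzx⟩ : ∃ x ∈ P, ∃ z ∉ P, algebraMap B K z = y * algebraMap B K x := by
    by_contra! hcon
    refine hy (hcic y (isAlmostIntegral_of_mul_mem hPbot fun x hx => ?_))
    obtain ⟨z, hz⟩ := hyP x hx
    exact ⟨z, by_contra fun hzP => hcon x hx z hzP hz, hz⟩
  obtain ⟨w, q, hq, hwq⟩ := hP.exists_inv hz
  let J : FractionalIdeal (nonZeroDivisors B) K :=
    FractionalIdeal.spanSingleton _ 1 + FractionalIdeal.spanSingleton _ y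
  have hinv : (P : FractionalIdeal (nonZeroDivisors B) K) * J = 1 := by
    apply le_antisymm
    · rw [FractionalIdeal.mul_le]
      intro i hi j hj
      obtain ⟨i, hiP, rfl⟩ := (FractionalIdeal.mem_coeIdeal _).1 hi
      obtain ⟨a, ha, b, hb, rfl⟩ := (FractionalIdeal.mem_add _ _ _).1 hj
      obtain ⟨a, rfl⟩ := (FractionalIdeal.mem_spanSingleton _).1 ha
      obtain ⟨b, rfl⟩ := (FractionalIdeal.mem_spanSingleton _).1 hb
      obtain ⟨k, hk⟩ := hyP i hiP
      rw [FractionalIdeal.mem_one_iff]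
      refine ⟨i * a + b * k, ?_⟩
      rw [map_add, map_mul, map_mul, hk, Algebra.smul_def, Algebra.smul_def]
      ring
    · rw [FractionalIdeal.one_le]
      have h1 : (1 : K) = algebraMap B K q * 1 + algebraMap B K (w * x) * y := by
        have := congrArg (algebraMap B K) hwq
        rw [map_add, map_mul, hzx, map_one] at this
        rw [← this, map_mul]
        linear_combination (-algebraMap B K q) * this
      rw [h1]
      refine Submodule.add_mem _
        (FractionalIdeal.mul_mem_mul (FractionalIdeal.mem_coeIdeal_of_mem _ hq) ?_)
        (FractionalIdeal.mul_mem_mul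
          (FractionalIdeal.mem_coeIdeal_of_mem _ (P.mul_mem_left w hx)) ?_)
      · exact (FractionalIdeal.mem_add _ _ _).2
          ⟨1, FractionalIdeal.mem_spanSingleton_self _ _, 0, Submodule.zero_mem _, by simp⟩
      · exact (FractionalIdeal.mem_add _ _ _).2
          ⟨0, Submodule.zero_mem _, y, FractionalIdeal.mem_spanSingleton_self _ _, by simp⟩
  exact (IsLocalization.coeSubmodule_isPrincipal K le_rfl).1
    (FractionalIdeal.isPrincipal.of_finite_maximals_of_inv le_rfl
      (h.finite_isMaximal ht0 ht hB) _ J hinv)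

/-- A nonzero prime `P` strictly inside the maximal ideal `(q)` would satisfy `q⁻¹ P ⊆ P`, so that
`q⁻¹ ∈ B`. Hence all primes are principal. -/
theorem HasFiniteDuals.isPrincipalIdealRing (h : HasFiniteDuals B K)
    (hcic : ∀ x : K, IsAlmostIntegral B x → x ∈ (algebraMap B K).range) {t : B}
    (ht0 : t ≠ 0) (ht : ∀ P : Ideal B, P.IsPrime → P ≠ ⊥ → t ∈ P) (hB : ¬IsField B) :
    IsPrincipalIdealRing B := by
  refine IsPrincipalIdealRing.of_prime_ne_bot fun P hP hP0 => ?_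
  obtain ⟨Q, hQ, hPQ⟩ := P.exists_le_maximal hP.ne_top
  obtain ⟨q, hq⟩ := h.isPrincipal_of_isMaximal hcic ht0 ht hB hQ
  have hq0 : q ≠ 0 := by
    rintro rfl
    rw [Submodule.span_zero_singleton] at hq
    exact Ring.ne_bot_of_isMaximal_of_not_isField hQ hB hq
  have hqK : algebraMap B K q ≠ 0 := by rwa [Ne, FaithfulSMul.algebraMap_eq_zero_iff]
  by_cases hqP : q ∈ P
  · refine ⟨q, le_antisymm (hq ▸ hPQ) ?_⟩
    rwa [Submodule.span_singleton_le_iff_mem]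
  · exfalso
    obtain ⟨b, hb⟩ : (algebraMap B K q)⁻¹ ∈ (algebraMap B K).range := by
      refine hcic _ (isAlmostIntegral_of_mul_mem hP0 fun x hx => ?_)
      have hxq := hPQ hx
      rw [hq, Submodule.mem_span_singleton] at hxq
      obtain ⟨z, rfl⟩ := hxq
      refine ⟨z, (hP.mem_or_mem hx).resolve_right hqP, ?_⟩
      rw [smul_eq_mul, map_mul]
      field_simp
    refine hQ.ne_top (Q.eq_top_of_isUnit_mem (hq ▸ Submodule.mem_span_singleton_self q)
      (IsUnit.of_mul_eq_one b (FaithfulSMul.algebraMap_injective B K ?_)))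
    rw [map_mul, hb, mul_inv_cancel₀ hqK, map_one]

end SemilocalPID

/-! ### Factorization in monoids with a prime system -/

section PrimeSystem

variable {F : Type*} [CommMonoid F] {s : ℕ} {p : Fin s → F}

theorem factorMap_mul (x y : Fˣ × (Fin s → ℕ)) :
    factorMap p (x.1 * y.1, x.2 + y.2) = factorMap p x * factorMap p y := by
  simp only [factorMap, Units.val_mul, Pi.add_apply, pow_add, Finset.prod_mul_distrib]
  exact mul_mul_mul_comm _ _ _ _

theorem IsPrimeSystem.val_factorMap (hp : IsPrimeSystem p) (x : Fˣ × (Fin s → ℕ)) :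
    hp.val (factorMap p x) = x.2 := by
  rw [IsPrimeSystem.val]
  congr 1
  exact (Equiv.ofBijective (factorMap p) hp).symm_apply_apply x

theorem IsPrimeSystem.exists_eq (hp : IsPrimeSystem p) (a : F) :
    ∃ u : Fˣ, a = u * ∏ i, p i ^ hp.val a i := by
  obtain ⟨⟨u, n⟩, rfl⟩ := hp.2 a
  exact ⟨u, by rw [hp.val_factorMap]; rfl⟩

theorem IsPrimeSystem.val_mul (hp : IsPrimeSystem p) (a b : F) :
    hp.val (a * b) = hp.val a + hp.val b := by
  obtain ⟨x, rfl⟩ := hp.2 a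
  obtain ⟨y, rfl⟩ := hp.2 b
  rw [← factorMap_mul, hp.val_factorMap, hp.val_factorMap, hp.val_factorMap]

theorem IsPrimeSystem.isUnit_of_val_eq_zero (hp : IsPrimeSystem p) {a : F} (ha : hp.val a = 0) :
    IsUnit a := by
  obtain ⟨u, hu⟩ := hp.exists_eq a
  rw [ha] at hu
  simp only [Pi.zero_apply, pow_zero, Finset.prod_const_one, mul_one] at hu
  exact ⟨u, hu.symm⟩

theorem IsPrimeSystem.val_self (hp : IsPrimeSystem p) (i : Fin s) :
    hp.val (p i) = Pi.single i 1 := by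
  have : p i = factorMap p (1, Pi.single i 1) := by
    rw [factorMap, Finset.prod_eq_single i]
    · simp
    · intro j _ hj
      simp [hj]
    · simp
  rw [this, hp.val_factorMap]

/-- The members of a prime system are irreducible. -/
theorem IsPrimeSystem.isUnit_or_isUnit (hp : IsPrimeSystem p) {i : Fin s} {a b : F}
    (h : p i = a * b) : IsUnit a ∨ IsUnit b := by
  have hab : hp.val a + hp.val b = Pi.single i 1 := by rw [← hp.val_mul, ← h, hp.val_self]
  have hne : ∀ j, j ≠ i → hp.val a j = 0 ∧ hp.val b j = 0 := by
    intro j hj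
    have := congrFun hab j
    rw [Pi.add_apply, Pi.single_eq_of_ne hj] at this
    omega
  have hi := congrFun hab i
  rw [Pi.add_apply, Pi.single_eq_same] at hi
  rcases Nat.eq_zero_or_pos (hp.val a i) with h0 | h0
  · left
    refine hp.isUnit_of_val_eq_zero (funext fun j => ?_)
    by_cases hj : j = i
    · rw [hj, h0]; rfl
    · exact (hne j hj).1
  · right
    refine hp.isUnit_of_val_eq_zero (funext fun j => ?_)
    by_cases hj : j = i
    · rw [hj, Pi.zero_apply]
      omega
    · exact (hne j hj).2

end PrimeSystem

/-! ### Nonzero elements of a semilocal principal ideal domain -/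

section NonzeroMonoid

variable {B K : Type*} [CommRing B] [Field K] [Algebra B K]

theorem mem_nonzeroMonoid {x : Kˣ} :
    x ∈ nonzeroMonoid B K ↔ ∃ b : B, algebraMap B K b = x :=
  Iff.rfl

/-- The unit group of the monoid `B^•` is `B^×`. -/
theorem mem_unitGroup_nonzeroMonoid [FaithfulSMul B K] {x : Kˣ} :
    x ∈ unitGroup (nonzeroMonoid B K) ↔ ∃ b : B, IsUnit b ∧ algebraMap B K b = x := by
  constructor
  · rintro ⟨⟨b, hb⟩, ⟨c, hc⟩⟩
    refine ⟨b, IsUnit.of_mul_eq_one c (FaithfulSMul.algebraMap_injective B K ?_), hb⟩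
    rw [map_mul, map_one]
    erw [hb, hc]
    simp
  · rintro ⟨_, ⟨u, rfl⟩, hu⟩
    refine ⟨⟨u, hu⟩, ⟨(u⁻¹ : Bˣ), ?_⟩⟩
    have h1 : algebraMap B K u * algebraMap B K (u⁻¹ : Bˣ) = 1 := by
      rw [← map_mul, Units.mul_inv, map_one]
    rw [hu] at h1
    exact (Units.inv_eq_of_mul_eq_one_right h1).symm

theorem mem_unitGroup_iff_isUnit [FaithfulSMul B K] {x : Kˣ} {b : B}
    (hb : algebraMap B K b = x) : x ∈ unitGroup (nonzeroMonoid B K) ↔ IsUnit b := by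
  rw [mem_unitGroup_nonzeroMonoid]
  constructor
  · rintro ⟨c, hc, hcx⟩
    rwa [FaithfulSMul.algebraMap_injective B K (hb.trans hcx.symm)]
  · exact fun h => ⟨b, h, hb⟩

theorem isUnit_of_isUnit_nonzeroMonoid [FaithfulSMul B K] {x : nonzeroMonoid B K} (hx : IsUnit x)
    {b : B} (hb : algebraMap B K b = (x : Kˣ)) : IsUnit b := by
  obtain ⟨u, rfl⟩ := hx
  rw [← mem_unitGroup_iff_isUnit hb]
  refine ⟨u.1.2, ?_⟩
  have : ((u : nonzeroMonoid B K) : Kˣ)⁻¹ = ((u⁻¹ : (nonzeroMonoid B K)ˣ) : nonzeroMonoid B K) := by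
    rw [inv_eq_iff_mul_eq_one, ← Submonoid.coe_mul, Units.mul_inv, Submonoid.coe_one]
  rw [this]
  exact (u⁻¹).1.2

/-- The element of `B^•` given by a nonzero element of `B`. -/
noncomputable def nonzeroMonoid.mk [FaithfulSMul B K] (b : B) (hb : b ≠ 0) : nonzeroMonoid B K :=
  ⟨Units.mk0 (algebraMap B K b) (by rwa [Ne, FaithfulSMul.algebraMap_eq_zero_iff]), b, rfl⟩

@[simp]
theorem nonzeroMonoid.coe_mk [FaithfulSMul B K] (b : B) (hb : b ≠ 0) :
    ((nonzeroMonoid.mk b hb : nonzeroMonoid B K) : Kˣ) = algebraMap B K b :=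
  rfl

theorem isUnit_nonzeroMonoid_mk [FaithfulSMul B K] {b : B} (hb : b ≠ 0) (hu : IsUnit b) :
    IsUnit (nonzeroMonoid.mk b hb : nonzeroMonoid B K) := by
  obtain ⟨u, rfl⟩ := hu
  have : Nontrivial B := ⟨_, _, hb⟩
  refine IsUnit.of_mul_eq_one (nonzeroMonoid.mk (u⁻¹ : Bˣ) (Units.ne_zero _)) ?_
  apply Subtype.ext
  apply Units.ext
  rw [Submonoid.coe_mul, Units.val_mul, nonzeroMonoid.coe_mk, nonzeroMonoid.coe_mk, ← map_mul,
    Units.mul_inv, map_one]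
  rfl

end NonzeroMonoid

section SemilocalPrimes

variable {B K : Type*} [CommRing B] [Field K] [Algebra B K] {s : ℕ}

/-- `q` is a system of representatives, up to associates, of the prime elements of `B`, where `B`
is a principal ideal domain with finitely many maximal ideals. -/
structure IsPrimeRepr (q : Fin s → B) : Prop where
  prime (i : Fin s) : Prime (q i)
  eq_of_dvd {i j : Fin s} : q i ∣ q j → i = j
  exists_mem (P : Ideal B) : P.IsMaximal → ∃ i, q i ∈ P

theorem exists_isPrimeRepr [IsDomain B] [IsPrincipalIdealRing B] (hB : ¬IsField B)
    (hfin : {P : Ideal B | P.IsMaximal}.Finite) :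
    ∃ q : Fin ({P : Ideal B | P.IsMaximal}.ncard) → B, IsPrimeRepr q := by
  have := hfin.to_subtype
  let e : Fin ({P : Ideal B | P.IsMaximal}.ncard) ≃ {P : Ideal B | P.IsMaximal} :=
    (Finite.equivFin _).symm
  let q := fun i => Submodule.IsPrincipal.generator (e i).1
  have hq : ∀ i, Ideal.span {q i} = (e i).1 := fun i => Ideal.span_singleton_generator _
  refine ⟨q, fun i => ?_, fun {i j} hij => ?_, fun P hP => ?_⟩
  · have hmax : (e i).1.IsMaximal := (e i).2
    exact Submodule.IsPrincipal.prime_generator_of_isPrime _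
      (Ring.ne_bot_of_isMaximal_of_not_isField hmax hB)
  · have h1 : (e j).1 ≤ (e i).1 := by
      rw [← hq, ← hq]
      exact Ideal.span_singleton_le_span_singleton.2 hij
    have hmax : (e j).1.IsMaximal := (e j).2
    have hmax' : (e i).1.IsMaximal := (e i).2
    exact (e.injective (Subtype.ext (hmax.eq_of_le hmax'.ne_top h1))).symm
  · refine ⟨e.symm ⟨P, hP⟩, ?_⟩
    have : Ideal.span {q (e.symm ⟨P, hP⟩)} = P := by rw [hq, e.apply_symm_apply]
    exact this.le (Ideal.mem_span_singleton_self _)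

namespace IsPrimeRepr

variable {q : Fin s → B}

theorem isUnit_of_forall_not_dvd [IsDomain B] [IsPrincipalIdealRing B] (hq : IsPrimeRepr q) {b : B}
    (h : ∀ i, ¬q i ∣ b) : IsUnit b := by
  by_contra hb
  obtain ⟨P, hP, hbP⟩ := exists_max_ideal_of_mem_nonunits hb
  obtain ⟨i, hi⟩ := hq.exists_mem P hP
  have hmax : (Ideal.span {q i}).IsMaximal :=
    PrincipalIdealRing.isMaximal_of_irreducible (hq.prime i).irreducible
  have := hmax.eq_of_le hP.ne_top ((Ideal.span_singleton_le_iff_mem _).2 hi)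
  rw [← this] at hbP
  exact h i (Ideal.mem_span_singleton.1 hbP)

theorem not_dvd_prod (hq : IsPrimeRepr q) {i : Fin s} {T : Finset (Fin s)} (hT : i ∉ T)
    (n : Fin s → ℕ) :
    ¬q i ∣ ∏ j ∈ T, q j ^ n j := by
  intro h
  obtain ⟨j, hj, hij⟩ := (hq.prime i).exists_mem_finset_dvd h
  rw [hq.eq_of_dvd ((hq.prime i).dvd_of_dvd_pow hij)] at hT
  exact hT hj

variable [IsDomain B]

theorem pow_dvd_iff (hq : IsPrimeRepr q) {i : Fin s} {u : B} (hu : IsUnit u)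
    (n : Fin s → ℕ) {k : ℕ} :
    q i ^ k ∣ u * ∏ j, q j ^ n j ↔ k ≤ n i := by
  constructor
  · intro h
    by_contra! hk
    rw [hu.dvd_mul_left, ← Finset.mul_prod_erase _ _ (Finset.mem_univ i)] at h
    have h2 : q i ^ n i * q i ∣ q i ^ n i * ∏ j ∈ Finset.univ.erase i, q j ^ n j := by
      refine dvd_trans ?_ h
      rw [← pow_succ]
      exact pow_dvd_pow _ hk
    rw [mul_dvd_mul_iff_left (pow_ne_zero _ (hq.prime i).ne_zero)] at h2
    exact hq.not_dvd_prod (by simp) n h2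
  · intro h
    exact ((pow_dvd_pow _ h).trans
      (Finset.dvd_prod_of_mem (fun j => q j ^ n j) (Finset.mem_univ i))).mul_left u

variable [IsPrincipalIdealRing B]

theorem exists_eq (hq : IsPrimeRepr q) {b : B} (hb : b ≠ 0) :
    ∃ (u : B) (n : Fin s → ℕ), IsUnit u ∧ b = u * ∏ j, q j ^ n j := by
  induction b using UniqueFactorizationMonoid.induction_on_prime with
  | h₁ => exact absurd rfl hb
  | h₂ x hx => exact ⟨x, 0, hx, by simp⟩
  | h₃ a r ha hr ih =>
    obtain ⟨u, n, hu, rfl⟩ := ih ha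
    obtain ⟨i, hi⟩ : ∃ i, q i ∣ r := by
      by_contra! hcon
      exact hr.not_isUnit (hq.isUnit_of_forall_not_dvd hcon)
    obtain ⟨v, hv⟩ := ((hq.prime i).associated_of_dvd hr hi)
    refine ⟨v * u, n + Pi.single i 1, v.isUnit.mul hu, ?_⟩
    have : ∏ j, q j ^ (Pi.single i 1 : Fin s → ℕ) j = q i := by
      rw [Finset.prod_eq_single i]
      · simp
      · intro j _ hj
        simp [hj]
      · simp
    simp only [Pi.add_apply, pow_add, Finset.prod_mul_distrib, this]
    rw [← hv]
    ring

theorem prod_pow_dvd (hq : IsPrimeRepr q) {b : B} {k : ℕ} (h : ∀ i, q i ^ k ∣ b) :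
    (∏ i, q i) ^ k ∣ b := by
  by_cases hb : b = 0
  · rw [hb]
    exact dvd_zero _
  obtain ⟨u, n, hu, rfl⟩ := hq.exists_eq hb
  rw [← Finset.prod_pow]
  exact (Finset.prod_dvd_prod_of_dvd _ _ fun i _ =>
    pow_dvd_pow _ ((hq.pow_dvd_iff hu n).1 (h i))).mul_left u

theorem isPrimeSystem (hq : IsPrimeRepr q) [FaithfulSMul B K] :
    IsPrimeSystem fun i => (nonzeroMonoid.mk (q i) (hq.prime i).ne_zero : nonzeroMonoid B K) := by
  set p : Fin s → nonzeroMonoid B K :=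
    fun i => (nonzeroMonoid.mk (q i) (hq.prime i).ne_zero : nonzeroMonoid B K) with hp
  have hcoe : ∀ n : Fin s → ℕ, (((∏ i, p i ^ n i : nonzeroMonoid B K) : Kˣ) : K) =
      algebraMap B K (∏ i, q i ^ n i) := by
    intro n
    simp [hp]
  have hunit : ∀ u : (nonzeroMonoid B K)ˣ, ∃ b : B, IsUnit b ∧
      algebraMap B K b = ((u : nonzeroMonoid B K) : Kˣ) := by
    intro u
    obtain ⟨b, hb⟩ := u.1.2
    exact ⟨b, isUnit_of_isUnit_nonzeroMonoid u.isUnit hb, hb⟩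
  have hval : ∀ x : (nonzeroMonoid B K)ˣ × (Fin s → ℕ), ∃ b, IsUnit b ∧
      algebraMap B K (b * ∏ i, q i ^ x.2 i) = ((factorMap p x : nonzeroMonoid B K) : Kˣ) := by
    intro x
    obtain ⟨b, hb, hbx⟩ := hunit x.1
    refine ⟨b, hb, ?_⟩
    rw [factorMap, Submonoid.coe_mul, Units.val_mul, hcoe, map_mul, hbx]
  constructor
  · intro x y hxy
    obtain ⟨b, hb, hbx⟩ := hval x
    obtain ⟨c, hc, hcy⟩ := hval y
    have h2 : x.2 = y.2 := by
      have heq : b * ∏ i, q i ^ x.2 i = c * ∏ i, q i ^ y.2 i := by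
        apply FaithfulSMul.algebraMap_injective B K
        rw [hbx, hcy, hxy]
      funext i
      apply le_antisymm
      · rw [← hq.pow_dvd_iff hc, ← heq, hq.pow_dvd_iff hb]
      · rw [← hq.pow_dvd_iff hb, heq, hq.pow_dvd_iff hc]
    refine Prod.ext (Units.ext ?_) h2
    rw [factorMap, factorMap, h2] at hxy
    exact mul_right_cancel hxy
  · intro x
    obtain ⟨b, hb⟩ := x.2
    have hb0 : b ≠ 0 := by
      rintro rfl
      exact x.1.ne_zero (hb.symm.trans (map_zero (algebraMap B K)))
    obtain ⟨u, n, hu, rfl⟩ := hq.exists_eq hb0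
    obtain ⟨v, hv⟩ := isUnit_nonzeroMonoid_mk (K := K) hu.ne_zero hu
    refine ⟨(v, n), ?_⟩
    apply Subtype.ext
    apply Units.ext
    rw [factorMap, Submonoid.coe_mul, Units.val_mul, hcoe, hv, nonzeroMonoid.coe_mk, ← map_mul]
    exact hb

/-- The exponents of `x` count the powers of the `q i` dividing it in `B`. -/
theorem le_val_iff (hq : IsPrimeRepr q) [FaithfulSMul B K] {x : nonzeroMonoid B K} {b : B}
    (hb : algebraMap B K b = (x : Kˣ)) {i : Fin s} {k : ℕ} :
    k ≤ (hq.isPrimeSystem (K := K)).val x i ↔ q i ^ k ∣ b := by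
  obtain ⟨u, hu⟩ := (hq.isPrimeSystem (K := K)).exists_eq x
  obtain ⟨c, hc⟩ := u.1.2
  have hcu := isUnit_of_isUnit_nonzeroMonoid u.isUnit hc
  have : b = c * ∏ j, q j ^ (hq.isPrimeSystem (K := K)).val x j := by
    apply FaithfulSMul.algebraMap_injective B K
    rw [hb]
    nth_rw 1 [hu]
    have hc' : algebraMap B K c = ((u : nonzeroMonoid B K) : Kˣ) := hc
    rw [Submonoid.coe_mul, Units.val_mul, map_mul, hc']
    simp
  rw [this, hq.pow_dvd_iff hcu]

/-- The primes can be normalized so that each of them is congruent to `1` modulo high powers of all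
the others. -/
theorem exists_normalized (hq : IsPrimeRepr q) {N : ℕ} (hN : 0 < N) :
     ∃ r : Fin s → B, IsPrimeRepr r ∧ (∀ i, Associated (q i) (r i)) ∧
    ∀ i, ∀ j ≠ i, q j ^ N ∣ r i - 1 := by
  have key : ∀ i, ∃ r, Associated (q i) r ∧ ∀ j ≠ i, q j ^ N ∣ r - 1 := by
    intro i
    set c := ∏ j ∈ Finset.univ.erase i, q j ^ N with hc
    have hcop : IsCoprime (q i) c := by
      rw [(hq.prime i).coprime_iff_not_dvd]
      exact hq.not_dvd_prod (by simp) _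
    obtain ⟨x, y, hxy⟩ := hcop
    -- `w` is congruent to `1` modulo `q i` and to `x`, an inverse of `q i`, modulo `c`.
    set w := x * (x * q i) + y * c with hw
    have hwc : c ∣ q i * w - 1 := by
      refine ⟨q i * y - y * (1 + x * q i), ?_⟩
      rw [hw]
      linear_combination (1 + x * q i) * hxy
    have hdvd : ∀ j ≠ i, q j ^ N ∣ q i * w - 1 := fun j hj =>
      (Finset.dvd_prod_of_mem (fun j => q j ^ N)
        (Finset.mem_erase.2 ⟨hj, Finset.mem_univ j⟩)).trans hwc
    have hwu : IsUnit w := by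
      refine hq.isUnit_of_forall_not_dvd fun j hj => ?_
      by_cases hji : j = i
      · subst hji
        have h1 : q j ∣ y * c := by
          have := dvd_sub hj (Dvd.intro_left (x * x) rfl : q j ∣ x * x * q j)
          rwa [hw, ← mul_assoc, add_sub_cancel_left] at this
        refine (hq.prime j).not_isUnit (isUnit_of_dvd_one ?_)
        rw [← hxy]
        exact dvd_add (Dvd.intro_left _ rfl) h1
      · have h1 : q j ∣ q i * w - 1 := (dvd_pow_self _ hN.ne').trans (hdvd j hji)
        refine (hq.prime j).not_isUnit (isUnit_of_dvd_one ?_)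
        have := dvd_sub (hj.mul_left (q i)) h1
        rwa [sub_sub_cancel] at this
    exact ⟨q i * w, ⟨hwu.unit, rfl⟩, hdvd⟩
  choose r hr hrN using key
  refine ⟨r, ⟨fun i => (hr i).prime (hq.prime i), fun {i j} hij => hq.eq_of_dvd ?_, fun P hP => ?_⟩,
    hr, hrN⟩
  · exact (hr i).dvd.trans (hij.trans (hr j).symm.dvd)
  · obtain ⟨i, hi⟩ := hq.exists_mem P hP
    exact ⟨i, P.mem_of_dvd (hr i).dvd hi⟩

end IsPrimeRepr

end SemilocalPrimes

/-! ### One-dimensional local Mori domains with nonzero conductor -/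

section OneDim

/-- The local domain `A` with quotient field `K` is one-dimensional, satisfies the finiteness
property of Mori domains, and has a nonzero conductor in its complete integral closure. -/
structure IsOneDimLocalMori (A K : Type*) [CommRing A] [IsLocalRing A] [Field K] [Algebra A K] :
    Prop where
  hasFiniteDuals : HasFiniteDuals A K
  hatConductor_ne_bot : hatConductor A K ≠ ⊥
  eq_maximalIdeal (P : Ideal A) : P.IsPrime → P ≠ ⊥ → P = IsLocalRing.maximalIdeal A
  not_isField : ¬IsField A

variable {A K : Type*} [CommRing A] [Field K] [Algebra A K]

variable (A K) in
/-- The conductor `(A : Â)`, as an ideal of the complete integral closure `Â` of `A`. -/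
def hatConductorIdeal : Ideal (completeIntegralClosure A K) where
  carrier := {b | ∀ y : completeIntegralClosure A K, (b * y : K) ∈ (algebraMap A K).range}
  zero_mem' := fun y => by simp
  add_mem' := by
    intro a b ha hb y
    rw [Subalgebra.coe_add, add_mul]
    exact add_mem (ha y) (hb y)
  smul_mem' := by
    intro c a ha y
    convert ha (c * y) using 1
    simp only [smul_eq_mul, Subalgebra.coe_mul]
    ring

theorem algebraMap_mem_hatConductorIdeal {a : A} :
    algebraMap A (completeIntegralClosure A K) a ∈ hatConductorIdeal A K ↔ a ∈ hatConductor A K :=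
  ⟨fun h y hy => h ⟨y, hy⟩, fun h y => h y y.2⟩

theorem exists_mem_hatConductor {b : completeIntegralClosure A K}
    (hb : b ∈ hatConductorIdeal A K) :
    ∃ a ∈ hatConductor A K, algebraMap A (completeIntegralClosure A K) a = b := by
  obtain ⟨a, ha⟩ := hb 1
  have hab : algebraMap A (completeIntegralClosure A K) a = b := by
    apply Subtype.ext
    rw [OneMemClass.coe_one, mul_one] at ha
    exact ha
  refine ⟨a, ?_, hab⟩
  rwa [← algebraMap_mem_hatConductorIdeal, hab]

theorem algebraMap_completeIntegralClosure_injective [FaithfulSMul A K] :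
    Function.Injective (algebraMap A (completeIntegralClosure A K)) := fun _ _ h =>
  FaithfulSMul.algebraMap_injective A K (congrArg Subtype.val h)

/-- The complete integral closure of the monoid `A^•` is `Â^•`. -/
theorem hatMonoid_nonzeroMonoid [IsDomain A] [IsFractionRing A K] :
    hatMonoid (nonzeroMonoid A K) = nonzeroMonoid (completeIntegralClosure A K) K := by
  ext x
  constructor
  · rintro ⟨-, c, ⟨a, ha⟩, hcx⟩
    have ha' : algebraMap A K a = c := ha
    refine ⟨⟨x, a, mem_nonZeroDivisors_of_ne_zero ?_, fun n => ?_⟩, rfl⟩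
    · rintro rfl
      exact c.ne_zero (by rw [← ha', map_zero])
    · rw [Algebra.smul_def, ha']
      rcases Nat.eq_zero_or_pos n with rfl | hn
      · exact ⟨a, by rw [ha', pow_zero, mul_one]⟩
      · obtain ⟨r, hr⟩ := hcx n hn
        exact ⟨r, hr⟩
  · rintro ⟨⟨_, a, ha, hax⟩, rfl⟩
    have ha0 : algebraMap A K a ≠ 0 := by
      rw [Ne, FaithfulSMul.algebraMap_eq_zero_iff]
      exact nonZeroDivisors.ne_zero ha
    refine ⟨?_, Units.mk0 _ ha0, ⟨a, rfl⟩, fun n _ => ?_⟩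
    · obtain ⟨r, t, ht, hrt⟩ := IsFractionRing.div_surjective (A := A) (x : K)
      have ht0 : algebraMap A K t ≠ 0 := by
        rw [Ne, FaithfulSMul.algebraMap_eq_zero_iff]
        exact nonZeroDivisors.ne_zero ht
      have hr0 : algebraMap A K r ≠ 0 := by
        intro h
        rw [h, zero_div] at hrt
        exact x.ne_zero hrt.symm
      have hx : x = Units.mk0 _ hr0 * (Units.mk0 _ ht0)⁻¹ := by
        apply Units.ext
        rw [← hrt, div_eq_mul_inv]
        rfl
      rw [hx]
      exact mul_mem (Subgroup.subset_closure ⟨r, rfl⟩)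
        (inv_mem (Subgroup.subset_closure ⟨t, rfl⟩))
    · have := hax n
      rw [Algebra.smul_def] at this
      obtain ⟨r, hr⟩ := this
      exact ⟨r, hr⟩

namespace IsOneDimLocalMori

variable [IsLocalRing A] [IsFractionRing A K]

theorem hatConductorIdeal_ne_bot (h : IsOneDimLocalMori A K) : hatConductorIdeal A K ≠ ⊥ := by
  obtain ⟨d, hd, hd0⟩ := Submodule.exists_mem_ne_zero_of_ne_bot h.hatConductor_ne_bot
  intro hbot
  have := algebraMap_mem_hatConductorIdeal.2 hd
  rw [hbot, Ideal.mem_bot] at this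
  exact hd0 (algebraMap_completeIntegralClosure_injective (this.trans (map_zero _).symm))

/-- Every nonzero prime of `Â` meets `A` in the maximal ideal, as its trace contains multiples of
the nonzero conductor. -/
theorem comap_eq (h : IsOneDimLocalMori A K) {P : Ideal (completeIntegralClosure A K)}
    (hP : P.IsPrime) (hP0 : P ≠ ⊥) :
    P.comap (algebraMap A (completeIntegralClosure A K)) = IsLocalRing.maximalIdeal A := by
  refine h.eq_maximalIdeal _ (Ideal.comap_isPrime _ _) fun hbot => ?_
  obtain ⟨x, hx, hx0⟩ := Submodule.exists_mem_ne_zero_of_ne_bot hP0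
  obtain ⟨d, hd, hd0⟩ := Submodule.exists_mem_ne_zero_of_ne_bot h.hatConductorIdeal_ne_bot
  obtain ⟨a, -, ha⟩ := exists_mem_hatConductor (Ideal.mul_mem_right x _ hd)
  have haP : a ∈ P.comap (algebraMap A (completeIntegralClosure A K)) := by
    rw [Ideal.mem_comap, ha]
    exact P.mul_mem_left d hx
  rw [hbot, Ideal.mem_bot] at haP
  rw [haP, map_zero] at ha
  exact mul_ne_zero hd0 hx0 ha.symm

theorem not_isField_closure (h : IsOneDimLocalMori A K) :
    ¬IsField (completeIntegralClosure A K) := by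
  intro hB
  obtain ⟨d, hd, hd0⟩ := Submodule.exists_mem_ne_zero_of_ne_bot h.hatConductor_ne_bot
  have hdK : algebraMap A K d ≠ 0 := by rwa [Ne, FaithfulSMul.algebraMap_eq_zero_iff]
  have htop : ∀ x : K, x ∈ completeIntegralClosure A K := by
    intro x
    obtain ⟨a, b, hb, rfl⟩ := IsFractionRing.div_surjective (A := A) x
    have hb0 : algebraMap A K b ≠ 0 := by
      rw [Ne, FaithfulSMul.algebraMap_eq_zero_iff]
      exact nonZeroDivisors.ne_zero hb
    obtain ⟨c, hc⟩ := hB.mul_inv_cancel (a := algebraMap A (completeIntegralClosure A K) b)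
      fun h0 => hb0 (congrArg Subtype.val h0)
    have hc' : algebraMap A K b * c = 1 := congrArg Subtype.val hc
    rw [div_eq_mul_inv, ← eq_inv_of_mul_eq_one_right hc']
    exact mul_mem (Subalgebra.algebraMap_mem _ a) c.2
  refine h.not_isField ⟨exists_pair_ne A, mul_comm, fun {a} ha => ?_⟩
  have haK : algebraMap A K a ≠ 0 := by rwa [Ne, FaithfulSMul.algebraMap_eq_zero_iff]
  obtain ⟨b, hb⟩ := hd _ (htop ((algebraMap A K d)⁻¹ * (algebraMap A K a)⁻¹))
  refine ⟨b, FaithfulSMul.algebraMap_injective A K ?_⟩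
  rw [map_mul, hb, map_one]
  field_simp

theorem exists_mem_primes (h : IsOneDimLocalMori A K) :
    ∃ t : completeIntegralClosure A K, t ≠ 0 ∧ ∀ P : Ideal (completeIntegralClosure A K),
      P.IsPrime → P ≠ ⊥ → t ∈ P := by
  have hm : IsLocalRing.maximalIdeal A ≠ ⊥ := by
    intro hm
    exact h.not_isField (IsLocalRing.isField_iff_maximalIdeal_eq.2 hm)
  obtain ⟨t, ht, ht0⟩ := Submodule.exists_mem_ne_zero_of_ne_bot hm
  refine ⟨algebraMap A _ t, fun h0 => ht0
    (algebraMap_completeIntegralClosure_injective (h0.trans (map_zero _).symm)), fun P hP hP0 => ?_⟩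
  rw [← Ideal.mem_comap, h.comap_eq hP hP0]
  exact ht

theorem finite_isMaximal [IsDomain A] (h : IsOneDimLocalMori A K) :
    {P : Ideal (completeIntegralClosure A K) | P.IsMaximal}.Finite := by
  obtain ⟨t, ht0, ht⟩ := h.exists_mem_primes
  exact (h.hasFiniteDuals.completeIntegralClosure h.hatConductor_ne_bot).finite_isMaximal
    ht0 ht h.not_isField_closure

theorem isPrincipalIdealRing_closure [IsDomain A] (h : IsOneDimLocalMori A K) :
    IsPrincipalIdealRing (completeIntegralClosure A K) := by
  obtain ⟨t, ht0, ht⟩ := h.exists_mem_primes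
  exact (h.hasFiniteDuals.completeIntegralClosure h.hatConductor_ne_bot).isPrincipalIdealRing
    (fun x hx => algebraMap_range_completeIntegralClosure.2
      (mem_completeIntegralClosure_of_isAlmostIntegral h.hatConductor_ne_bot hx))
    ht0 ht h.not_isField_closure

theorem ncard_pos [IsDomain A] (h : IsOneDimLocalMori A K) :
    0 < {P : Ideal (completeIntegralClosure A K) | P.IsMaximal}.ncard := by
  rw [Set.ncard_pos h.finite_isMaximal]
  exact Ideal.exists_maximal _

theorem exists_isPrimeRepr [IsDomain A] (h : IsOneDimLocalMori A K) :
    ∃ q : Fin ({P : Ideal (completeIntegralClosure A K) | P.IsMaximal}.ncard) →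
      completeIntegralClosure A K, IsPrimeRepr q :=
  have := h.isPrincipalIdealRing_closure
  _root_.exists_isPrimeRepr h.not_isField_closure h.finite_isMaximal

variable {s : ℕ} {q : Fin s → completeIntegralClosure A K}

theorem dvd_iff_mem_maximalIdeal (h : IsOneDimLocalMori A K) (hq : IsPrimeRepr q) {i : Fin s}
    {a : A} : q i ∣ algebraMap A _ a ↔ a ∈ IsLocalRing.maximalIdeal A := by
  have hp : (Ideal.span {q i}).IsPrime :=
    (Ideal.span_singleton_prime (hq.prime i).ne_zero).2 (hq.prime i)
  have hbot : Ideal.span {q i} ≠ ⊥ := fun h0 =>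
    (hq.prime i).ne_zero (Ideal.span_singleton_eq_bot.1 h0)
  rw [← h.comap_eq hp hbot, Ideal.mem_comap, Ideal.mem_span_singleton]

theorem exists_pow_mem_hatConductorIdeal [IsDomain A] (h : IsOneDimLocalMori A K)
    (hq : IsPrimeRepr q) :
    ∃ N > 0, (∏ i, q i) ^ N ∈ hatConductorIdeal A K := by
  have := h.isPrincipalIdealRing_closure
  obtain ⟨d, hd, hd0⟩ := Submodule.exists_mem_ne_zero_of_ne_bot h.hatConductorIdeal_ne_bot
  obtain ⟨u, n, hu, rfl⟩ := hq.exists_eq hd0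
  refine ⟨1 + ∑ i, n i, by omega, Ideal.mem_of_dvd _ ?_ hd⟩
  rw [hu.mul_left_dvd, ← Finset.prod_pow]
  refine Finset.prod_dvd_prod_of_dvd _ _ fun i _ => pow_dvd_pow _ ?_
  have := Finset.single_le_sum (f := n) (fun _ _ => Nat.zero_le _) (Finset.mem_univ i)
  omega

theorem isFinitelyPrimaryWith [IsDomain A] (h : IsOneDimLocalMori A K) (hq : IsPrimeRepr q)
    (hs : 0 < s) {N : ℕ} (hN : 0 < N) (hNq : (∏ i, q i) ^ N ∈ hatConductorIdeal A K) :
    IsFinitelyPrimaryWith (nonzeroMonoid A K) s N := by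
  have := h.isPrincipalIdealRing_closure
  have hprod0 : ∏ i, q i ≠ 0 := Finset.prod_ne_zero_iff.2 fun i _ => (hq.prime i).ne_zero
  refine ⟨hs, hN, nonzeroMonoid (completeIntegralClosure A K) K, ?_, _,
    hq.isPrimeSystem (K := K), ?_, ?_⟩
  · rintro x ⟨a, ha⟩
    exact ⟨algebraMap A _ a, ha⟩
  · rintro x ⟨a, ha⟩ hx
    have ha' : algebraMap A K a = x := ha
    rw [mem_unitGroup_iff_isUnit ha', ← mem_nonunits_iff, ← IsLocalRing.mem_maximalIdeal] at hx
    have hdvd : (∏ i, q i) ^ 1 ∣ algebraMap A _ a := hq.prod_pow_dvd fun i => by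
      rw [pow_one]
      exact (h.dvd_iff_mem_maximalIdeal hq).2 hx
    rw [pow_one] at hdvd
    obtain ⟨c, hc⟩ := hdvd
    have hc0 : c ≠ 0 := by
      rintro rfl
      rw [mul_zero] at hc
      exact x.ne_zero (ha'.symm.trans (congrArg Subtype.val hc))
    refine ⟨_, (nonzeroMonoid.mk (K := K) c hc0).2, Units.ext ?_⟩
    rw [Units.val_mul, nonzeroMonoid.coe_mk, ← ha', Units.coe_prod]
    simp only [nonzeroMonoid.coe_mk]
    rw [← map_prod, ← map_mul, ← hc]
    rfl
  · rintro x ⟨b, hb⟩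
    obtain ⟨a, ha⟩ := hNq b
    refine ⟨a, ?_⟩
    have hb' : (b : K) = x := hb
    refine ha.trans ?_
    rw [hb', Units.coeHom_apply, Units.val_mul, Units.val_pow_eq_pow_val, Units.coe_prod]
    simp only [nonzeroMonoid.coe_mk]
    rw [← map_prod, ← map_pow]
    rfl

theorem isFinitelyPrimary [IsDomain A] (h : IsOneDimLocalMori A K) :
    IsFinitelyPrimary (nonzeroMonoid A K) := by
  obtain ⟨q, hq⟩ := h.exists_isPrimeRepr
  obtain ⟨N, hN, hNq⟩ := h.exists_pow_mem_hatConductorIdeal hq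
  exact ⟨_, N, h.isFinitelyPrimaryWith hq h.ncard_pos hN hNq⟩

end IsOneDimLocalMori

end OneDim

/-! ### The strongly ring-like property -/

section StronglyRingLike

/-- A prime system of `B^•` has at least as many members as `B` has maximal ideals. -/
theorem encard_isMaximal_le {B K : Type*} [CommRing B] [IsDomain B] [IsPrincipalIdealRing B]
    [Field K] [Algebra B K] [FaithfulSMul B K] (hB : ¬IsField B) {s : ℕ}
    {p : Fin s → nonzeroMonoid B K} (hp : IsPrimeSystem p) :
    {P : Ideal B | P.IsMaximal}.encard ≤ s := by
  have hpb : ∀ i, ∃ b : B, algebraMap B K b = (p i : Kˣ) := fun i => (p i).2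
  choose b hb using hpb
  have hmem : ∀ P : {P : Ideal B | P.IsMaximal}, ∃ i, b i ∈ P.1 := by
    rintro ⟨P, hP⟩
    have hP' : P.IsMaximal := hP
    obtain ⟨x, hx, hx0⟩ := Submodule.exists_mem_ne_zero_of_ne_bot
      (Ring.ne_bot_of_isMaximal_of_not_isField hP hB)
    obtain ⟨u, hu⟩ := hp.exists_eq (nonzeroMonoid.mk x hx0)
    obtain ⟨c, hc⟩ := u.1.2
    have hcu : IsUnit c := isUnit_of_isUnit_nonzeroMonoid u.isUnit hc
    have hxc : x = c * ∏ i, b i ^ hp.val (nonzeroMonoid.mk x hx0) i := by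
      apply FaithfulSMul.algebraMap_injective B K
      rw [← nonzeroMonoid.coe_mk x hx0]
      nth_rw 1 [hu]
      have hc' : algebraMap B K c = ((u : nonzeroMonoid B K) : Kˣ) := hc
      rw [Submonoid.coe_mul, Units.val_mul, map_mul, hc']
      simp [hb]
    rw [hxc] at hx
    have h1 := (hP'.isPrime.mem_or_mem hx).resolve_left fun h =>
      hP'.ne_top (P.eq_top_of_isUnit_mem h hcu)
    obtain ⟨i, -, hi⟩ := hP'.isPrime.prod_mem_iff.1 h1
    exact ⟨i, hP'.isPrime.mem_of_pow_mem _ hi⟩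
  choose f hf using hmem
  have hinj : Function.Injective f := by
    rintro ⟨P, hP⟩ ⟨P', hP'⟩ hPP'
    have hPm : P.IsMaximal := hP
    have hPm' : P'.IsMaximal := hP'
    by_contra hne
    have hne' : P ≠ P' := fun h => hne (Subtype.ext h)
    -- Two distinct maximal ideals containing `p i` would give a factorization of `p i`.
    obtain ⟨x, rfl⟩ := (IsPrincipalIdealRing.principal P).principal
    obtain ⟨y, rfl⟩ := (IsPrincipalIdealRing.principal P').principal
    have hx := hf ⟨_, hP⟩
    have hy := hf ⟨_, hP'⟩
    rw [← hPP'] at hy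
    obtain ⟨c, hc⟩ := Ideal.mem_span_singleton.1 hx
    have hxu : ¬IsUnit x := fun h => hPm.ne_top (Ideal.span_singleton_eq_top.2 h)
    have hyu : ¬IsUnit y := fun h => hPm'.ne_top (Ideal.span_singleton_eq_top.2 h)
    have hyc : y ∣ c := by
      rw [← Ideal.mem_span_singleton]
      rw [hc] at hy
      refine (hPm'.isPrime.mem_or_mem hy).resolve_left fun h => hne' ?_
      exact hPm.eq_of_le hPm'.ne_top ((Ideal.span_singleton_le_iff_mem _).2 h)
    obtain ⟨e, rfl⟩ := hyc
    set i := f ⟨_, hP⟩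
    have h0 : x * (y * e) ≠ 0 := by
      intro h0
      have := hb i
      rw [hc, h0, map_zero] at this
      exact (p i : Kˣ).ne_zero this.symm
    have hfac : p i = nonzeroMonoid.mk x (left_ne_zero_of_mul h0) *
        nonzeroMonoid.mk (y * e) (right_ne_zero_of_mul h0) := by
      apply Subtype.ext
      apply Units.ext
      rw [Submonoid.coe_mul, Units.val_mul, nonzeroMonoid.coe_mk, nonzeroMonoid.coe_mk, ← map_mul,
        ← hc, hb]
    rcases hp.isUnit_or_isUnit hfac with hu | hu
    · exact hxu (isUnit_of_isUnit_nonzeroMonoid hu (nonzeroMonoid.coe_mk _ _).symm)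
    · exact hyu (isUnit_of_mul_isUnit_left
        (isUnit_of_isUnit_nonzeroMonoid hu (nonzeroMonoid.coe_mk _ _).symm))
  calc {P : Ideal B | P.IsMaximal}.encard = ENat.card {P : Ideal B | P.IsMaximal} := rfl
    _ ≤ ENat.card (Fin s) := ENat.card_le_card_of_injective hinj
    _ = s := by simp

variable {A K : Type*} [CommRing A] [Field K] [Algebra A K] [IsFractionRing A K]

/-- Finiteness of `B^× / A^×`, expressed by representatives in `B`. -/
theorem finite_unitGroup_quotient_iff {B : Type*} [CommRing B] [Algebra B K] [FaithfulSMul B K]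
    [Algebra A B] [IsScalarTower A B K] :
    Finite (unitGroup (nonzeroMonoid B K) ⧸
        (unitGroup (nonzeroMonoid A K)).subgroupOf (unitGroup (nonzeroMonoid B K))) ↔
      ∃ S : Finset B, (∀ u ∈ S, IsUnit u) ∧
        ∀ x : B, IsUnit x → ∃ u ∈ S, ∃ a : A, IsUnit a ∧ x = algebraMap A B a * u := by
  have hG : ∀ g : unitGroup (nonzeroMonoid B K), ∃ b : B, IsUnit b ∧ algebraMap B K b = (g : Kˣ) :=
    fun g => mem_unitGroup_nonzeroMonoid.1 g.2
  choose b hbu hb using hG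
  have hB : ∀ x : B, IsUnit x → ∃ g : unitGroup (nonzeroMonoid B K), b g = x := by
    rintro _ ⟨x, rfl⟩
    refine ⟨⟨Units.map (algebraMap B K) x, mem_unitGroup_nonzeroMonoid.2 ⟨x, x.isUnit, rfl⟩⟩, ?_⟩
    apply FaithfulSMul.algebraMap_injective B K
    rw [hb]
    rfl
  have hrel : ∀ g g' : unitGroup (nonzeroMonoid B K),
      (QuotientGroup.mk g : _ ⧸ (unitGroup (nonzeroMonoid A K)).subgroupOf _) =
          QuotientGroup.mk g' ↔
        ∃ a : A, IsUnit a ∧ b g' = algebraMap A B a * b g := by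
    intro g g'
    rw [QuotientGroup.eq, Subgroup.mem_subgroupOf, mem_unitGroup_nonzeroMonoid]
    refine exists_congr fun a => and_congr_right fun _ => ?_
    rw [← (FaithfulSMul.algebraMap_injective B K).eq_iff, map_mul, hb, hb,
      ← IsScalarTower.algebraMap_apply, Subgroup.coe_mul, Subgroup.coe_inv, Units.val_mul,
      Units.val_inv_eq_inv_val, eq_comm, inv_mul_eq_iff_eq_mul₀ (Units.ne_zero _), mul_comm]
  constructor
  · intro hfin
    refine ⟨(Set.finite_range fun c : unitGroup (nonzeroMonoid B K) ⧸
        (unitGroup (nonzeroMonoid A K)).subgroupOf (unitGroup (nonzeroMonoid B K)) =>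
          b c.out).toFinset, ?_, fun x hx => ?_⟩
    · intro u hu
      obtain ⟨c, rfl⟩ := (Set.Finite.mem_toFinset _).1 hu
      exact hbu _
    · obtain ⟨g, rfl⟩ := hB x hx
      refine ⟨_, (Set.Finite.mem_toFinset _).2 ⟨QuotientGroup.mk g, rfl⟩, ?_⟩
      exact (hrel _ _).1 (QuotientGroup.out_eq' _)
  · rintro ⟨S, hSu, hS⟩
    choose g hg using hB
    refine Finite.of_surjective (fun u : S => QuotientGroup.mk (g u (hSu u u.2))) fun c => ?_
    induction c using QuotientGroup.induction_on with
    | H g' =>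
      obtain ⟨u, hu, a, ha, hau⟩ := hS (b g') (hbu g')
      exact ⟨⟨u, hu⟩, (hrel _ _).2 ⟨a, ha, by rw [hg]; exact hau⟩⟩

/-- The strongly ring-like property of `A^•`, with `Â^•` in place of the monoid closure. -/
theorem isStronglyRingLike_nonzeroMonoid_iff [IsDomain A] {s : ℕ} :
    IsStronglyRingLike (nonzeroMonoid A K) s ↔
      ∃ α : ℕ, IsFinitelyPrimaryWith (nonzeroMonoid A K) s α ∧
        ∃ (p : Fin s → nonzeroMonoid (completeIntegralClosure A K) K) (hp : IsPrimeSystem p),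
          (∀ (i : Fin s) (a : nonzeroMonoid (completeIntegralClosure A K) K), α ≤ hp.val a i →
            (((p i * a : nonzeroMonoid (completeIntegralClosure A K) K) : Kˣ) ∈
              nonzeroMonoid A K ↔ (a : Kˣ) ∈ nonzeroMonoid A K)) ∧
          (∃ S : Finset (completeIntegralClosure A K), (∀ u ∈ S, IsUnit u) ∧
            ∀ x : completeIntegralClosure A K, IsUnit x →
              ∃ u ∈ S, ∃ a : A, IsUnit a ∧ x = algebraMap A _ a * u) ∧
          ∃ m : Fin s → ℕ,
            IsLeast {v | ∃ a : nonzeroMonoid (completeIntegralClosure A K) K,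
              (a : Kˣ) ∈ nonzeroMonoid A K ∧ (a : Kˣ) ∉ unitGroup (nonzeroMonoid A K) ∧
                v = hp.val a} m := by
  rw [← finite_unitGroup_quotient_iff (K := K), ← hatMonoid_nonzeroMonoid]
  rfl

/-- Units of `Â` that are congruent modulo the conductor differ by a unit of `A`. -/
theorem exists_unit_representatives
    [Finite (completeIntegralClosure A K ⧸ hatConductorIdeal A K)] :
    ∃ S : Finset (completeIntegralClosure A K), (∀ u ∈ S, IsUnit u) ∧
      ∀ x : completeIntegralClosure A K, IsUnit x →
        ∃ u ∈ S, ∃ a : A, IsUnit a ∧ x = algebraMap A _ a * u := by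
  classical
  have hinj := algebraMap_completeIntegralClosure_injective (A := A) (K := K)
  let B := completeIntegralClosure A K
  have hex : ∀ c : B ⧸ hatConductorIdeal A K, ∃ u : Bˣ,
      (∃ x : Bˣ, Ideal.Quotient.mk (hatConductorIdeal A K) (x : B) = c) →
        Ideal.Quotient.mk (hatConductorIdeal A K) (u : B) = c := by
    intro c
    by_cases hc : ∃ x : Bˣ, Ideal.Quotient.mk (hatConductorIdeal A K) (x : B) = c
    · obtain ⟨x, hx⟩ := hc
      exact ⟨x, fun _ => hx⟩
    · exact ⟨1, fun hc' => absurd hc' hc⟩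
  choose f hf using hex
  refine ⟨(Set.finite_range fun c => (f c : B)).toFinset, ?_, ?_⟩
  · intro u hu
    obtain ⟨c, rfl⟩ := (Set.Finite.mem_toFinset _).1 hu
    exact (f c).isUnit
  · rintro _ ⟨x, rfl⟩
    set u := f (Ideal.Quotient.mk (hatConductorIdeal A K) (x : B)) with hu
    refine ⟨u, (Set.Finite.mem_toFinset _).2 ⟨_, rfl⟩, ?_⟩
    have hux : (u : B) - x ∈ hatConductorIdeal A K := Ideal.Quotient.eq.1 (hf _ ⟨x, rfl⟩)
    -- `x / u` and `u / x` both lie in `1 + (A : Â)`.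
    obtain ⟨a, -, ha⟩ := exists_mem_hatConductor
      (Ideal.mul_mem_right ((u⁻¹ : Bˣ) : B) _ (neg_mem hux))
    obtain ⟨a', -, ha'⟩ := exists_mem_hatConductor (Ideal.mul_mem_right ((x⁻¹ : Bˣ) : B) _ hux)
    have h1 : algebraMap A B (1 + a) = x * (u⁻¹ : Bˣ) := by
      rw [map_add, map_one, ha, neg_sub, sub_mul, Units.mul_inv]
      ring
    have h2 : algebraMap A B (1 + a') = u * (x⁻¹ : Bˣ) := by
      rw [map_add, map_one, ha', sub_mul, Units.mul_inv]
      ring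
    refine ⟨1 + a, IsUnit.of_mul_eq_one (1 + a') (hinj ?_), ?_⟩
    · rw [map_mul, map_one]
      erw [h1, h2]
      rw [mul_assoc, Units.inv_mul_cancel_left, Units.mul_inv]
    · erw [h1]
      rw [Units.inv_mul_cancel_right]

namespace IsOneDimLocalMori

variable [IsLocalRing A]

/-- If `Â^× / A^×` is finite and `A ≠ Â`, the residue field of `A` is finite: for any
`z ∈ Â \ A`, the units of the form `z + a` with `a ∈ A` lie in the same class modulo `A^×` only
if their parameters `a` have the same residue. -/
theorem finite_residue [IsDomain A] (h : IsOneDimLocalMori A K)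
    (hle : hatConductor A K ≤ IsLocalRing.maximalIdeal A)
    {S : Finset (completeIntegralClosure A K)}
    (hS : ∀ x : completeIntegralClosure A K, IsUnit x →
      ∃ u ∈ S, ∃ a : A, IsUnit a ∧ x = algebraMap A _ a * u) :
    Finite (A ⧸ IsLocalRing.maximalIdeal A) := by
  obtain ⟨z, hz⟩ : ∃ z : completeIntegralClosure A K, ∀ a : A, algebraMap A _ a ≠ z := by
    by_contra! hcon
    refine (IsLocalRing.maximalIdeal.isMaximal A).ne_top ((Ideal.eq_top_iff_one _).2 (hle ?_))
    intro y hy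
    obtain ⟨a, ha⟩ := hcon ⟨y, hy⟩
    refine ⟨a, ?_⟩
    rw [map_one, one_mul]
    exact congrArg Subtype.val ha
  have hmem : ∀ P : Ideal (completeIntegralClosure A K), P.IsMaximal → ∀ a : A,
      algebraMap A _ a ∈ P → a ∈ IsLocalRing.maximalIdeal A := by
    intro P hP a ha
    rwa [← Ideal.mem_comap,
      h.comap_eq hP.isPrime (Ring.ne_bot_of_isMaximal_of_not_isField hP h.not_isField_closure)]
      at ha
  let σ : A ⧸ IsLocalRing.maximalIdeal A → A := Quotient.out
  have hσ : ∀ c c', σ c - σ c' ∈ IsLocalRing.maximalIdeal A → c = c' := by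
    intro c c' hcc
    rw [← Ideal.Quotient.eq] at hcc
    have hout : ∀ c, Ideal.Quotient.mk (IsLocalRing.maximalIdeal A) (σ c) = c :=
      fun c => Quotient.out_eq' c
    rwa [hout, hout] at hcc
  set good : Set (A ⧸ IsLocalRing.maximalIdeal A) :=
    {c | IsUnit (z + algebraMap A _ (σ c))} with hgood
  have hbad : goodᶜ.Finite := by
    have := h.finite_isMaximal.to_subtype
    have hex : ∀ c : (goodᶜ : Set _), ∃ P : {P : Ideal (completeIntegralClosure A K) | P.IsMaximal},
        z + algebraMap A _ (σ c) ∈ P.1 := by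
      rintro ⟨c, hc⟩
      obtain ⟨P, hP, hcP⟩ := exists_max_ideal_of_mem_nonunits hc
      exact ⟨⟨P, hP⟩, hcP⟩
    choose f hf using hex
    refine Set.finite_coe_iff.1 (Finite.of_injective f fun c c' hcc => Subtype.ext (hσ _ _ ?_))
    refine hmem (f c).1 (f c).2 _ ?_
    have h2 := hf c'
    rw [← hcc] at h2
    rw [map_sub, ← add_sub_add_left_eq_sub _ _ z]
    exact sub_mem (hf c) h2
  have hgoodfin : good.Finite := by
    choose f hfS a ha hfa using fun c : good => hS _ c.2
    refine Set.finite_coe_iff.1 (Finite.of_injective (fun c => (⟨f c, hfS c⟩ : S))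
      fun c c' hcc => Subtype.ext (hσ _ _ ?_))
    have hff : f c = f c' := congrArg Subtype.val hcc
    have h1 := hfa c
    have h2 := hfa c'
    rw [← hff] at h2
    have h3 : algebraMap A (completeIntegralClosure A K) (a c * σ c' - a c' * σ c) =
        algebraMap A _ (a c' - a c) * z := by
      simp only [map_sub, map_mul]
      linear_combination algebraMap A _ (a c) * h2 - algebraMap A _ (a c') * h1
    have h4 : a c' - a c ∈ IsLocalRing.maximalIdeal A := by
      rw [IsLocalRing.mem_maximalIdeal, mem_nonunits_iff]
      rintro ⟨w, hw⟩
      refine hz ((w⁻¹ : Aˣ) * (a c * σ c' - a c' * σ c)) ?_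
      rw [map_mul, h3, ← hw, ← mul_assoc, ← map_mul, Units.inv_mul, map_one, one_mul]
    obtain ⟨P, hP⟩ := Ideal.exists_maximal (completeIntegralClosure A K)
    have h5 : a c * σ c' - a c' * σ c ∈ IsLocalRing.maximalIdeal A := by
      refine hmem P hP _ ?_
      rw [h3]
      refine P.mul_mem_right _ ?_
      rw [← Ideal.mem_comap, h.comap_eq hP.isPrime
        (Ring.ne_bot_of_isMaximal_of_not_isField hP h.not_isField_closure)]
      exact h4
    have h6 : a c * (σ c - σ c') ∈ IsLocalRing.maximalIdeal A := by
      have := sub_mem (neg_mem h5) (Ideal.mul_mem_right (σ c) _ h4)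
      convert this using 1
      ring
    exact (Ideal.unit_mul_mem_iff_mem _ (ha c)).1 h6
  rw [← Set.finite_univ_iff, ← Set.union_compl_self good]
  exact hgoodfin.union hbad

/-- If `Â^× / A^×` is finite, then `Â` is a finite `A`-module. -/
theorem moduleFinite_of_units [IsDomain A] (h : IsOneDimLocalMori A K)
    {S : Finset (completeIntegralClosure A K)}
    (hS : ∀ x : completeIntegralClosure A K, IsUnit x →
      ∃ u ∈ S, ∃ a : A, IsUnit a ∧ x = algebraMap A _ a * u) :
    Module.Finite A (completeIntegralClosure A K) := by
  classical
  have := h.isPrincipalIdealRing_closure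
  obtain ⟨q, hq⟩ := h.exists_isPrimeRepr
  let Y := (Finset.univ : Finset (Finset (Fin _))).image fun T => ∏ i ∈ T, q i
  refine ⟨⟨S ∪ Y, eq_top_iff.2 fun b _ => ?_⟩⟩
  -- Adding to `b` the product of the primes that do not divide `b` gives a unit.
  set T := Finset.univ.filter fun i => ¬q i ∣ b with hT
  have hu : IsUnit (b + ∏ i ∈ T, q i) := by
    refine hq.isUnit_of_forall_not_dvd fun i hi => ?_
    by_cases hib : q i ∣ b
    · have h1 := (dvd_add_right hib).1 hi
      refine hq.not_dvd_prod (i := i) (T := T) (by simp [hT, hib]) 1 ?_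
      simpa using h1
    · exact hib ((dvd_add_left (Finset.dvd_prod_of_mem q (by simp [hT, hib]))).1 hi)
  obtain ⟨u, huS, a, -, ha⟩ := hS _ hu
  rw [eq_sub_of_add_eq ha, ← Algebra.smul_def]
  refine sub_mem (Submodule.smul_mem _ _ (Submodule.subset_span ?_)) (Submodule.subset_span ?_)
  · simp [huS]
  · simp only [Finset.coe_union, Set.mem_union]
    exact Or.inr (Finset.mem_coe.2 (Finset.mem_image_of_mem _ (Finset.mem_univ T)))

theorem finite_quotient_hatConductorIdeal [IsDomain A] (h : IsOneDimLocalMori A K)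
    [Module.Finite A (completeIntegralClosure A K)] [Finite (A ⧸ IsLocalRing.maximalIdeal A)] :
    Finite (completeIntegralClosure A K ⧸ hatConductorIdeal A K) := by
  have := h.isPrincipalIdealRing_closure
  obtain ⟨q, hq⟩ := h.exists_isPrimeRepr
  obtain ⟨N, hN, hNq⟩ := h.exists_pow_mem_hatConductorIdeal hq
  set J := (IsLocalRing.maximalIdeal A).map (algebraMap A (completeIntegralClosure A K)) with hJ
  have hfin := Submodule.finite_quotient_smul (IsLocalRing.maximalIdeal A)
    (N := (⊤ : Submodule A (completeIntegralClosure A K))) Module.Finite.fg_top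
  rw [Ideal.smul_top_eq_map] at hfin
  have : Finite (completeIntegralClosure A K ⧸ J) := hfin
  have hpow := Ideal.finite_quotient_pow (I := J) (IsNoetherian.noetherian J) N
  have hJle : J ^ N ≤ hatConductorIdeal A K := by
    have h1 : J ≤ Ideal.span {∏ i, q i} := by
      rw [hJ, Ideal.map_le_iff_le_comap]
      intro a ha
      rw [Ideal.mem_comap, Ideal.mem_span_singleton]
      have := hq.prod_pow_dvd (b := algebraMap A _ a) (k := 1) fun i => by
        rw [pow_one]
        exact (h.dvd_iff_mem_maximalIdeal hq).2 ha
      rwa [pow_one] at this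
    refine (Ideal.pow_right_mono h1 N).trans ?_
    rw [Ideal.span_singleton_pow, Ideal.span_singleton_le_iff_mem]
    exact hNq
  exact Finite.of_surjective _ (Ideal.Quotient.factor_surjective hJle)

/-- The conductor `𝔣` is principal over `Â`, hence finitely generated over `A`, and `A / 𝔣` is
finite. So the maximal ideal of `A` is finitely generated, and Cohen's theorem applies. -/
theorem isNoetherianRing [IsDomain A] (h : IsOneDimLocalMori A K)
    (hle : hatConductor A K ≤ IsLocalRing.maximalIdeal A)
    [Module.Finite A (completeIntegralClosure A K)] [Finite (A ⧸ IsLocalRing.maximalIdeal A)] :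
    IsNoetherianRing A := by
  have := h.isPrincipalIdealRing_closure
  have := h.finite_quotient_hatConductorIdeal
  have hfin : Finite (A ⧸ hatConductor A K) := by
    have hcomap : hatConductor A K =
        (hatConductorIdeal A K).comap (algebraMap A (completeIntegralClosure A K)) :=
      Ideal.ext fun a => algebraMap_mem_hatConductorIdeal.symm
    rw [hcomap]
    exact Finite.of_injective _ (Ideal.quotientMap_injective (f := algebraMap A _)
      (I := hatConductorIdeal A K))
  have hfg : (hatConductor A K).FG := by
    obtain ⟨c, hc⟩ := (IsPrincipalIdealRing.principal (hatConductorIdeal A K)).principal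
    have hcm : c ∈ hatConductorIdeal A K := hc ▸ Submodule.mem_span_singleton_self c
    let f : A →ₗ[A] completeIntegralClosure A K := Algebra.linearMap A _
    have hmap : Submodule.map f (hatConductor A K) =
        Submodule.map (LinearMap.mulLeft A c) ⊤ := by
      ext b
      constructor
      · rintro ⟨a, ha, rfl⟩
        have := algebraMap_mem_hatConductorIdeal.2 ha
        rw [hc, Submodule.mem_span_singleton] at this
        obtain ⟨e, he⟩ := this
        exact ⟨e, trivial, by rw [LinearMap.mulLeft_apply, mul_comm]; exact he⟩
      · rintro ⟨e, -, rfl⟩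
        obtain ⟨a, ha, hae⟩ := exists_mem_hatConductor (Ideal.mul_mem_right e _ hcm)
        exact ⟨a, ha, hae⟩
    refine Submodule.fg_of_fg_map_injective f algebraMap_completeIntegralClosure_injective ?_
    rw [hmap]
    exact Module.Finite.fg_top.map _
  refine IsNoetherianRing.of_prime_ne_bot fun P hP hP0 => ?_
  rw [h.eq_maximalIdeal P hP hP0]
  refine Submodule.fg_of_fg_map_of_fg_inf_ker (hatConductor A K).mkQ ?_ ?_
  · have : IsNoetherian A (A ⧸ hatConductor A K) := isNoetherian_of_finite _ _
    exact IsNoetherian.noetherian _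
  · rw [Submodule.ker_mkQ, inf_eq_right.2 hle]
    exact hfg

theorem moduleFinite_of_isNoetherianRing (h : IsOneDimLocalMori A K) [IsNoetherianRing A] :
    Module.Finite A (completeIntegralClosure A K) := by
  obtain ⟨d, hd, hd0⟩ := Submodule.exists_mem_ne_zero_of_ne_bot h.hatConductorIdeal_ne_bot
  have hex : ∀ b : completeIntegralClosure A K, ∃ a : A, algebraMap A _ a = d * b := fun b => by
    obtain ⟨a, -, ha⟩ := exists_mem_hatConductor (Ideal.mul_mem_right b _ hd)
    exact ⟨a, ha⟩
  choose f hf using hex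
  have hinj := algebraMap_completeIntegralClosure_injective (A := A) (K := K)
  let g : completeIntegralClosure A K →ₗ[A] A :=
    { toFun := f
      map_add' := fun x y => hinj (by rw [map_add, hf, hf, hf, mul_add])
      map_smul' := fun a x => hinj (by
        rw [RingHom.id_apply, smul_eq_mul, map_mul, hf, hf, Algebra.smul_def]
        ring) }
  refine Module.Finite.of_injective g fun x y hxy => ?_
  have : d * x = d * y := by rw [← hf, ← hf]; exact congrArg _ hxy
  exact mul_left_cancel₀ hd0 this

/-- At most two primes are needed here: elements attaining the minimal exponent at one prime each
can be added to give an element attaining both minima. -/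
theorem exists_isLeast (h : IsOneDimLocalMori A K) {s : ℕ} (hs0 : 0 < s) (hs : s ≤ 2)
    {q : Fin s → completeIntegralClosure A K} [IsPrincipalIdealRing (completeIntegralClosure A K)]
    (hq : IsPrimeRepr q) :
    ∃ m : Fin s → ℕ,
      IsLeast {v | ∃ a : nonzeroMonoid (completeIntegralClosure A K) K,
        (a : Kˣ) ∈ nonzeroMonoid A K ∧ (a : Kˣ) ∉ unitGroup (nonzeroMonoid A K) ∧
          v = (hq.isPrimeSystem (K := K)).val a} m := by
  set V := {v | ∃ a : nonzeroMonoid (completeIntegralClosure A K) K,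
        (a : Kˣ) ∈ nonzeroMonoid A K ∧ (a : Kˣ) ∉ unitGroup (nonzeroMonoid A K) ∧
          v = (hq.isPrimeSystem (K := K)).val a} with hV
  have hVA : ∀ v ∈ V, ∃ a ∈ IsLocalRing.maximalIdeal A,
      ∀ i k, k ≤ v i ↔ q i ^ k ∣ algebraMap A _ a := by
    rintro v ⟨x, ⟨a, ha⟩, hx, rfl⟩
    have ha' : algebraMap A K a = (x : Kˣ) := ha
    rw [mem_unitGroup_iff_isUnit ha', ← mem_nonunits_iff, ← IsLocalRing.mem_maximalIdeal] at hx
    exact ⟨a, hx, fun i k => hq.le_val_iff ha'⟩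
  have hAV : ∀ a ∈ IsLocalRing.maximalIdeal A, a ≠ 0 → ∃ v ∈ V,
      ∀ i k, k ≤ v i ↔ q i ^ k ∣ algebraMap A _ a := by
    intro a ha ha0
    have hb0 : algebraMap A (completeIntegralClosure A K) a ≠ 0 := fun h0 =>
      ha0 (algebraMap_completeIntegralClosure_injective (h0.trans (map_zero _).symm))
    have hcoe := nonzeroMonoid.coe_mk (K := K) _ hb0
    rw [← IsScalarTower.algebraMap_apply] at hcoe
    refine ⟨_, ⟨nonzeroMonoid.mk _ hb0, ⟨a, hcoe.symm⟩, ?_, rfl⟩, fun i k =>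
      hq.le_val_iff (nonzeroMonoid.coe_mk (K := K) _ hb0).symm⟩
    rwa [mem_unitGroup_iff_isUnit hcoe.symm, ← mem_nonunits_iff, ← IsLocalRing.mem_maximalIdeal]
  have hne : V.Nonempty := by
    have hm : IsLocalRing.maximalIdeal A ≠ ⊥ := fun hm =>
      h.not_isField (IsLocalRing.isField_iff_maximalIdeal_eq.2 hm)
    obtain ⟨a, ha, ha0⟩ := Submodule.exists_mem_ne_zero_of_ne_bot hm
    obtain ⟨v, hv, -⟩ := hAV a ha ha0
    exact ⟨v, hv⟩
  have hmin : ∀ i, ∃ v ∈ V, ∀ w ∈ V, v i ≤ w i := by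
    intro i
    obtain ⟨v, hv, hvmin⟩ := (InvImage.wf (fun v : Fin s → ℕ => v i) Nat.lt_wfRel.wf).has_min V hne
    exact ⟨v, hv, fun w hw => not_lt.1 (hvmin w hw)⟩
  obtain rfl | rfl : s = 1 ∨ s = 2 := by omega
  · obtain ⟨v, hv, hvm⟩ := hmin 0
    refine ⟨v, hv, fun w hw i => ?_⟩
    rw [Subsingleton.elim i 0]
    exact hvm w hw
  · obtain ⟨v, hv, hvm⟩ := hmin 0
    obtain ⟨w, hw, hwm⟩ := hmin 1
    by_cases h1 : v 1 ≤ w 1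
    · refine ⟨v, hv, fun y hy i => ?_⟩
      fin_cases i
      · exact hvm y hy
      · exact h1.trans (hwm y hy)
    by_cases h0 : w 0 ≤ v 0
    · refine ⟨w, hw, fun y hy i => ?_⟩
      fin_cases i
      · exact h0.trans (hvm y hy)
      · exact hwm y hy
    -- The sum of two elements that are minimal at one prime each is minimal at both.
    push Not at h0 h1
    obtain ⟨a, ha, hav⟩ := hVA v hv
    obtain ⟨b, hb, hbw⟩ := hVA w hw
    have hna : ¬q 0 ^ (v 0 + 1) ∣ algebraMap A _ (a + b) := by
      rw [map_add, dvd_add_left ((hbw 0 _).1 h0), ← hav]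
      omega
    have hnb : ¬q 1 ^ (w 1 + 1) ∣ algebraMap A _ (a + b) := by
      rw [map_add, dvd_add_right ((hav 1 _).1 h1), ← hbw]
      omega
    obtain ⟨y, hy, hyab⟩ := hAV (a + b) (add_mem ha hb) (by
      rintro h0
      rw [h0, map_zero] at hna
      exact hna (dvd_zero _))
    rw [← hyab] at hna hnb
    refine ⟨y, hy, fun x hx i => ?_⟩
    fin_cases i
    · exact le_trans (by simpa using Nat.lt_succ_iff.1 (not_le.1 hna)) (hvm x hx)
    · exact le_trans (by simpa using Nat.lt_succ_iff.1 (not_le.1 hnb)) (hwm x hx)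

theorem isStronglyRingLike_iff [IsDomain A] (h : IsOneDimLocalMori A K)
    (hle : hatConductor A K ≤ IsLocalRing.maximalIdeal A) :
    (∃ s ≤ 2, IsStronglyRingLike (nonzeroMonoid A K) s) ↔
      IsNoetherianRing A ∧ Finite (A ⧸ IsLocalRing.maximalIdeal A) ∧
        {P : Ideal (completeIntegralClosure A K) | P.IsMaximal}.encard ≤ 2 := by
  have := h.isPrincipalIdealRing_closure
  constructor
  · rintro ⟨s, hs, hH⟩
    obtain ⟨α, -, p, hp, -, ⟨S, -, hS⟩, -⟩ := isStronglyRingLike_nonzeroMonoid_iff.1 hH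
    have := h.finite_residue hle hS
    have := h.moduleFinite_of_units hS
    refine ⟨h.isNoetherianRing hle, ‹_›, (encard_isMaximal_le h.not_isField_closure hp).trans ?_⟩
    exact_mod_cast hs
  · rintro ⟨hnoeth, hfin, hcard⟩
    have := h.moduleFinite_of_isNoetherianRing
    have := h.finite_quotient_hatConductorIdeal
    obtain ⟨q₀, hq₀⟩ := h.exists_isPrimeRepr
    obtain ⟨N, hN, hNq⟩ := h.exists_pow_mem_hatConductorIdeal hq₀
    obtain ⟨q, hq, hqq, hqN⟩ := hq₀.exists_normalized hN
    have hNq' : (∏ i, q i) ^ N ∈ hatConductorIdeal A K :=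
      Ideal.mem_of_dvd _
        (pow_dvd_pow_of_dvd (Finset.prod_dvd_prod_of_dvd _ _ fun i _ => (hqq i).dvd) N) hNq
    have hs : {P : Ideal (completeIntegralClosure A K) | P.IsMaximal}.ncard ≤ 2 := by
      rw [← h.finite_isMaximal.cast_ncard_eq] at hcard
      exact_mod_cast hcard
    refine ⟨_, hs, isStronglyRingLike_nonzeroMonoid_iff.2
      ⟨N, h.isFinitelyPrimaryWith hq h.ncard_pos hN hNq', _, hq.isPrimeSystem, ?_,
        exists_unit_representatives, h.exists_isLeast h.ncard_pos hs hq⟩⟩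
    intro i x hx
    obtain ⟨b, hb⟩ := x.2
    have hb' : (b : K) = (x : Kˣ) := hb
    have hib := (hq.le_val_iff hb').1 hx
    -- As `q i` is congruent to `1` modulo the other primes, `(q i - 1) * b` is in the conductor.
    have hmem : (q i - 1) * b ∈ hatConductorIdeal A K := by
      refine Ideal.mem_of_dvd _ (hq₀.prod_pow_dvd fun j => ?_) hNq
      by_cases hj : j = i
      · subst hj
        exact ((pow_dvd_pow_of_dvd (hqq j).dvd N).trans hib).mul_left _
      · exact (hqN i j hj).mul_right _
    obtain ⟨a, -, ha⟩ := exists_mem_hatConductor hmem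
    have ha' : algebraMap A K a = (q i - 1) * b := congrArg Subtype.val ha
    rw [mem_nonzeroMonoid, mem_nonzeroMonoid, Submonoid.coe_mul, Units.val_mul,
      nonzeroMonoid.coe_mk, ← hb']
    have hcoe : algebraMap (completeIntegralClosure A K) K (q i) = (q i : K) := rfl
    rw [hcoe]
    constructor
    · rintro ⟨r, hr⟩
      exact ⟨r - a, by rw [map_sub, hr, ha']; ring⟩
    · rintro ⟨r, hr⟩
      exact ⟨r + a, by rw [map_add, hr, ha']; ring⟩

end IsOneDimLocalMori

end StronglyRingLike

/-! ### Localization at a height-one prime -/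

section AtPrime

variable {R K : Type*} [CommRing R] [Field K] [Algebra R K]
  (p : Ideal R) [p.IsPrime]
  (Rp : Type*) [CommRing Rp] [Algebra R Rp] [IsLocalization.AtPrime Rp p]
  [Algebra Rp K] [IsScalarTower R Rp K]

theorem algebraMap_mem_maximalIdeal_iff [IsLocalRing Rp] {r : R} :
    algebraMap R Rp r ∈ IsLocalRing.maximalIdeal Rp ↔ r ∈ p := by
  rw [← Ideal.mem_comap]
  exact Iff.of_eq (congrArg (r ∈ ·) (IsLocalization.AtPrime.under_maximalIdeal Rp p))

variable {p}

theorem finite_quotient_maximalIdeal_iff [IsLocalRing Rp] :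
    Finite (Rp ⧸ IsLocalRing.maximalIdeal Rp) ↔ Finite (R ⧸ p) := by
  constructor
  · intro hfin
    have hcomap : p = (IsLocalRing.maximalIdeal Rp).comap (algebraMap R Rp) :=
      (IsLocalization.AtPrime.under_maximalIdeal Rp p).symm
    have hinj := Ideal.quotientMap_injective (f := algebraMap R Rp)
      (I := IsLocalRing.maximalIdeal Rp)
    rw [hcomap]
    exact Finite.of_injective _ hinj
  · intro hfin
    have : p.IsMaximal := Ideal.Quotient.maximal_of_isField _ (Finite.isField_of_domain _)
    exact Finite.of_equiv _ (IsLocalization.AtPrime.equivQuotMaximalIdeal p Rp).toEquiv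

variable [IsDomain R] [IsDomain Rp] [IsFractionRing R K]

/-- The conductor stays nonzero in `R_p` because complete integral closure commutes with
localization. -/
theorem isOneDimLocalMori_of_height_eq_one [IsLocalRing Rp]
    (hfd : HasFiniteDuals R K) (hcond : hatConductor R K ≠ ⊥) (hp : p.height = 1) :
    IsOneDimLocalMori Rp K := by
  have hinj : Function.Injective (algebraMap R Rp) :=
    IsLocalization.injective Rp p.primeCompl_le_nonZeroDivisors
  refine ⟨hfd.of_isLocalization p.primeCompl, ?_, fun P hP hP0 => ?_, fun hF => ?_⟩
  · obtain ⟨d, hd, hd0⟩ := Submodule.exists_mem_ne_zero_of_ne_bot hcond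
    refine (Submodule.ne_bot_iff _).2 ⟨algebraMap R Rp d, fun y hy => ?_, ?_⟩
    · obtain ⟨s, hs, hsy⟩ := (hfd.mem_completeIntegralClosure_iff (A' := Rp) p.primeCompl
        p.primeCompl_le_nonZeroDivisors).1 hy
      refine mem_range_of_mul_mem_range p.primeCompl hs ?_
      rw [← IsScalarTower.algebraMap_apply, mul_left_comm]
      exact mem_range_of_mem_range (hd _ hsy)
    · rwa [Ne, map_eq_zero_iff _ hinj]
  · have hle : P.comap (algebraMap R Rp) ≤ p := fun r hr =>
      (algebraMap_mem_maximalIdeal_iff p Rp).1 (IsLocalRing.le_maximalIdeal hP.ne_top hr)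
    have hPp : P.comap (algebraMap R Rp) = p := by
      by_contra hne
      have : p.FiniteHeight := ⟨Or.inr (by rw [hp]; exact ENat.one_ne_top)⟩
      have hlt := Ideal.height_strict_mono_of_isPrime_of_isPrime (lt_of_le_of_ne hle hne)
      rw [hp, Order.lt_one_iff, Ideal.height_eq_zero_iff_eq_bot] at hlt
      refine hP0 (eq_bot_iff.2 fun x hx => ?_)
      obtain ⟨⟨r, s⟩, hrs⟩ := IsLocalization.surj p.primeCompl x
      have hr : r ∈ P.comap (algebraMap R Rp) := by
        rw [Ideal.mem_comap, ← hrs]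
        exact P.mul_mem_right _ hx
      rw [hlt, Ideal.mem_bot] at hr
      rw [hr, map_zero] at hrs
      exact (mul_eq_zero.1 hrs).resolve_right (IsLocalization.map_units Rp s).ne_zero
    refine le_antisymm (IsLocalRing.le_maximalIdeal hP.ne_top) fun x hx => ?_
    obtain ⟨⟨r, s⟩, hrs⟩ := IsLocalization.surj p.primeCompl x
    have hr : r ∈ P.comap (algebraMap R Rp) := by
      rw [hPp, ← algebraMap_mem_maximalIdeal_iff p Rp, ← hrs]
      exact Ideal.mul_mem_right _ _ hx
    rw [Ideal.mem_comap, ← hrs] at hr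
    exact (Ideal.mul_unit_mem_iff_mem _ (IsLocalization.map_units Rp s)).1 hr
  · obtain ⟨t, ht, ht0⟩ := Submodule.exists_mem_ne_zero_of_ne_bot (p.ne_bot_of_height_eq_one hp)
    have := (algebraMap_mem_maximalIdeal_iff p Rp).2 ht
    rw [IsLocalRing.isField_iff_maximalIdeal_eq.1 hF, Ideal.mem_bot, map_eq_zero_iff _ hinj] at this
    exact ht0 this

/-- The conductor of `R_p` is the localization of that of `R`, because `(R : R̂)` is the dual
of a finite subset of `R̂`. -/
theorem hatConductor_le_maximalIdeal [IsLocalRing Rp] [IsFractionRing Rp K]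
    (hfd : HasFiniteDuals R K) (hcond : hatConductor R K ≠ ⊥) (hle : hatConductor R K ≤ p) :
    hatConductor Rp K ≤ IsLocalRing.maximalIdeal Rp := by
  intro a ha
  obtain ⟨d, hd, hd0⟩ := Submodule.exists_mem_ne_zero_of_ne_bot hcond
  obtain ⟨E, hE, hdual⟩ := hfd (completeIntegralClosure R K)
    ⟨algebraMap R K d, hd, by rwa [Ne, FaithfulSMul.algebraMap_eq_zero_iff]⟩
  have haE : algebraMap Rp K a ∈ dualSubmodule Rp K E := by
    intro e he
    exact ha e (hfd.mem_completeIntegralClosure_of_mem p.primeCompl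
      p.primeCompl_le_nonZeroDivisors (hE he))
  obtain ⟨s, hs, hsa⟩ := exists_mul_mem_range_of_finset (A := R) p.primeCompl E _ haE
  have hsD := hdual hsa
  obtain ⟨r, hr⟩ := hsD 1 (one_mem _)
  rw [mul_one] at hr
  have hrp : r ∈ p := hle fun y hy => by
    rw [hr]
    exact hsD y hy
  have hsr : algebraMap R Rp s * a = algebraMap R Rp r := by
    apply FaithfulSMul.algebraMap_injective Rp K
    rw [map_mul, ← IsScalarTower.algebraMap_apply, ← IsScalarTower.algebraMap_apply, hr]
  refine (Ideal.unit_mul_mem_iff_mem _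
    (IsLocalization.map_units Rp (⟨s, hs⟩ : p.primeCompl))).1 ?_
  rw [hsr, algebraMap_mem_maximalIdeal_iff p]
  exact hrp

end AtPrime

theorem proposition5p9
    {R K : Type*} [CommRing R] [Field K] [Algebra R K] [IsFractionRing R K]
    (hR : IsMoriDomain R K) (hcond : hatConductor R K ≠ ⊥)
    (p : Ideal R) [p.IsPrime] (hp : p.height = 1)
    (Rp : Type*) [CommRing Rp] [Algebra R Rp] [IsLocalization.AtPrime Rp p]
    [Algebra Rp K] [IsScalarTower R Rp K] :
    IsFinitelyPrimary (nonzeroMonoid Rp K) ∧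
    (∀ m : Ideal (completeIntegralClosure R K), m.IsPrime →
      m.comap (algebraMap R (completeIntegralClosure R K)) = p → m.height = 1) ∧
    {m : Ideal (completeIntegralClosure R K) | m.IsPrime ∧
        m.comap (algebraMap R (completeIntegralClosure R K)) = p} =
      {m : Ideal (completeIntegralClosure R K) | m.IsPrime ∧ m.height = 1 ∧
        m.comap (algebraMap R (completeIntegralClosure R K)) = p} ∧
    (hatConductor R K ≤ p →
      ((∃ s ≤ 2, IsStronglyRingLike (nonzeroMonoid Rp K) s) ↔
        IsNoetherianRing Rp ∧ Finite (R ⧸ p) ∧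
        {m : Ideal (completeIntegralClosure R K) | m.IsPrime ∧ m.height = 1 ∧
          m.comap (algebraMap R (completeIntegralClosure R K)) = p}.encard ≤ 2)) := by
  have hRdom := hR.1
  have : IsDomain Rp := IsLocalization.isDomain_of_le_nonZeroDivisors _
    p.primeCompl_le_nonZeroDivisors
  have : IsLocalRing Rp := IsLocalization.AtPrime.isLocalRing Rp p
  have : IsFractionRing Rp K :=
    IsFractionRing.isFractionRing_of_isDomain_of_isLocalization p.primeCompl Rp K
  have hfd := hR.hasFiniteDuals
  have h := isOneDimLocalMori_of_height_eq_one Rp hfd hcond hp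
  have := h.isPrincipalIdealRing_closure
  let D := completeIntegralClosure R K
  let B := completeIntegralClosure Rp K
  let : Algebra D B := ((algebraMap D K).codRestrict B fun x =>
    hfd.mem_completeIntegralClosure_of_mem p.primeCompl p.primeCompl_le_nonZeroDivisors
      x.2).toAlgebra
  have hDK : ∀ x : D, ((algebraMap D B x : B) : K) = x := fun x => rfl
  let M := Algebra.algebraMapSubmonoid D p.primeCompl
  have hRB : ∀ r : R, algebraMap D B (algebraMap R D r) = algebraMap Rp B (algebraMap R Rp r) :=
    fun r => Subtype.ext (IsScalarTower.algebraMap_apply R Rp K r)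
  have hloc : IsLocalization M B := by
    refine ⟨?_, ?_, ?_⟩
    · rintro ⟨_, s, hs, rfl⟩
      rw [hRB]
      exact (IsLocalization.map_units Rp (⟨s, hs⟩ : p.primeCompl)).map _
    · intro x
      obtain ⟨s, hs, hsx⟩ := (hfd.mem_completeIntegralClosure_iff (A' := Rp) p.primeCompl
        p.primeCompl_le_nonZeroDivisors).1 x.2
      refine ⟨⟨⟨_, hsx⟩, ⟨_, s, hs, rfl⟩⟩, Subtype.ext ?_⟩
      rw [mul_comm]
      rfl
    · intro x y hxy
      have hxy' : x = y := Subtype.ext (congrArg (fun z : B => (z : K)) hxy)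
      exact ⟨1, by rw [hxy']⟩
  have hcomap : ∀ P : Ideal B, P.IsMaximal →
      (P.comap (algebraMap D B)).comap (algebraMap R D) = p := by
    intro P hP
    ext r
    rw [Ideal.mem_comap, Ideal.mem_comap, hRB, ← Ideal.mem_comap, h.comap_eq hP.isPrime
      (Ring.ne_bot_of_isMaximal_of_not_isField hP h.not_isField_closure),
      algebraMap_mem_maximalIdeal_iff p]
  have hext : ∀ m : Ideal D, m.IsPrime → m.comap (algebraMap R D) = p →
      (m.map (algebraMap D B)).IsMaximal ∧ (m.map (algebraMap D B)).comap (algebraMap D B) = m := by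
    intro m hm hmp
    have hdisj : Disjoint (M : Set D) m := by
      rw [Set.disjoint_left]
      rintro _ ⟨s, hs, rfl⟩ hsm
      exact hs (hmp ▸ hsm)
    have hprime := IsLocalization.isPrime_of_isPrime_disjoint M B m hm hdisj
    have hunder : (m.map (algebraMap D B)).comap (algebraMap D B) = m :=
      IsLocalization.under_map_of_isPrime_disjoint M B hm hdisj
    refine ⟨hprime.isMaximal fun hbot => ?_, hunder⟩
    obtain ⟨t, ht, ht0⟩ :=
      Submodule.exists_mem_ne_zero_of_ne_bot (p.ne_bot_of_height_eq_one hp)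
    rw [← hmp, Ideal.mem_comap] at ht
    have htB := Ideal.mem_map_of_mem (algebraMap D B) ht
    rw [hbot, Ideal.mem_bot] at htB
    exact ht0 (FaithfulSMul.algebraMap_injective R K
      ((congrArg (fun z : B => (z : K)) htB).trans (map_zero _).symm))
  have hheight : ∀ m : Ideal D, m.IsPrime → m.comap (algebraMap R D) = p → m.height = 1 := by
    intro m hm hmp
    obtain ⟨hmax, hunder⟩ := hext m hm hmp
    rw [← hunder]
    exact (IsLocalization.height_under M _).trans
      (IsPrincipalIdealRing.height_eq_one_of_isMaximal _ h.not_isField_closure)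
  have hset : {m : Ideal D | m.IsPrime ∧ m.comap (algebraMap R D) = p} =
      {m : Ideal D | m.IsPrime ∧ m.height = 1 ∧ m.comap (algebraMap R D) = p} :=
    Set.ext fun m => ⟨fun hm => ⟨hm.1, hheight m hm.1 hm.2, hm.2⟩, fun hm => ⟨hm.1, hm.2.2⟩⟩
  refine ⟨h.isFinitelyPrimary, hheight, hset, fun hle => ?_⟩
  have himage : {m : Ideal D | m.IsPrime ∧ m.comap (algebraMap R D) = p} =
      (fun P : Ideal B => P.comap (algebraMap D B)) '' {P : Ideal B | P.IsMaximal} := by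
    ext m
    constructor
    · rintro ⟨hm, hmp⟩
      exact ⟨_, (hext m hm hmp).1, (hext m hm hmp).2⟩
    · rintro ⟨P, hP, rfl⟩
      have hP' : P.IsMaximal := hP
      exact ⟨Ideal.comap_isPrime _ _, hcomap P hP'⟩
  have hinj : Function.Injective fun P : Ideal B => P.comap (algebraMap D B) :=
    fun P Q hPQ => by
      rw [← IsLocalization.map_under M B P, ← IsLocalization.map_under M B Q]
      exact congrArg (Ideal.map (algebraMap D B)) hPQ
  rw [← hset, himage, hinj.injOn.encard_image, ← finite_quotient_maximalIdeal_iff (p := p) Rp]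
  exact h.isStronglyRingLike_iff (hatConductor_le_maximalIdeal Rp hfd hcond hle)
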